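/- Let $f\in\mathbb{R}[x]$ be a polynomial of degree $d$ with $f(x)>0$ for all real $x\ge 0$, and let $g(x)=x^d f(1/x)$. The series $$\zeta_f(s)=\sum_{n,m\ge 1}\Bigl(n\,m^{d+1} f\bigl(\tfrac{n}{m}\bigr)\Bigr)^{-s}$$ converges absolutely for $\Re(s)>\frac{2}{d+2}$ and has a meromorphic continuation to $\mathbb{C}$, again denoted $\zeta_f$. Write $[x^n]h(x)$ for the coefficient of $x^n$ in the power series expansion of $h$ around $x=0$, where $f(x)^{-s}$ and $g(x)^{-s}$ are taken with the principal branch near $x=0$ (note $f(0),g(0)>0$), and let $\zeta$ be the Riemann zeta function. (a) If $s_0\ne\frac{2}{d+2}$ is a pole of $\zeta_f$, then this pole is simple, $s_0\notin\mathbb{Z}$, $(d+1)s_0-1=-n$ for some integer $n\ge 0$, and $$\operatorname{Res}_{s=s_0}\zeta_f(s)=\frac{\zeta((d+2)s_0-1)}{d+1}\Bigl([x^n]f(x)^{-s_0}+[x^n]g(x)^{-s_0}\Bigr).$$ (b) At every $s_0\notin\mathbb{Z}$ with $(d+1)s_0-1=-n$, $n\ge 0$ an integer, $\zeta_f$ has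 at most a simple pole, and the same formula gives its residue there (the residue is $0$ when $\zeta_f$ has a removable singularity at $s_0$). -/

import Mathlib

open Filter Topology
open scoped Nat

/-- The `(n, m)`-th term `(n m^(d+1) f(n/m))^(-s)` of the double Dirichlet series attached to a real
polynomial `f` of degree `d`. The base is a real number, which is positive if `f` is positive on
the nonnegative reals. -/
noncomputable def zetaTerm (f : Polynomial ℝ) (s : ℂ) (p : ℕ+ × ℕ+) : ℂ :=
  (((p.1 : ℝ) * (p.2 : ℝ) ^ (f.natDegree + 1) * f.eval ((p.1 : ℝ) / (p.2 : ℝ)) : ℝ) : ℂ) ^ (-s)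

/-- `Z` is a meromorphic continuation to the complex plane of the double series of `f`: it is
meromorphic on `ℂ`, and in the half plane `2/(d+2) < Re s` the series converges absolutely, with
sum `Z s`. -/
structure IsZetaContinuation (f : Polynomial ℝ) (Z : ℂ → ℂ) : Prop where
  meromorphic : Meromorphic Z
  hasSum : ∀ s : ℂ, 2 / ((f.natDegree : ℝ) + 2) < s.re → HasSum (zetaTerm f s) (Z s)

/-- `Z` has a pole at `s₀`: its order there is negative. -/
def HasPoleAt (Z : ℂ → ℂ) (s₀ : ℂ) : Prop :=
  meromorphicOrderAt Z s₀ < 0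

/-- The coefficient of `x^n` in the expansion of `h` around `x = 0`. -/
noncomputable def taylorCoeffZero (h : ℂ → ℂ) (n : ℕ) : ℂ :=
  iteratedDeriv n h 0 / (n ! : ℂ)

/-- The function `x ↦ p(x)^a` of a complex variable (principal branch); it is analytic near `0`
if `p(0) > 0`. -/
noncomputable def polyCpow (p : Polynomial ℝ) (a : ℂ) (x : ℂ) : ℂ :=
  (Polynomial.aeval x p) ^ a

/-- The reciprocal polynomial `g(x) = x^d f(1/x)` is `f.reverse`. -/
theorem reverse_eval_eq (f : Polynomial ℝ) (x : ℝ) (hx : x ≠ 0) :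
    f.reverse.eval x = x ^ f.natDegree * f.eval (1 / x) := by
  let _ : Invertible (1 / x) := invertibleOfNonzero (one_div_ne_zero hx)
  have h := Polynomial.eval₂_reverse_mul_pow (RingHom.id ℝ) (1 / x) f
  have h2 : ⅟ (1 / x) = x := by simp
  rw [h2] at h
  simp only [Polynomial.eval₂_id] at h
  have h3 : x ^ f.natDegree * (1 / x) ^ f.natDegree = 1 := by
    rw [← mul_pow, mul_one_div_cancel hx, one_pow]
  rw [← h, mul_left_comm, h3, mul_one]

/-- The number `ζ((d+2)s₀-1)/(d+1) · ([x^n] f(x)^(-s₀) + [x^n] g(x)^(-s₀))`, with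
`g(x) = x^d f(1/x)`. -/
noncomputable def residueValue (f : Polynomial ℝ) (s₀ : ℂ) (n : ℕ) : ℂ :=
  riemannZeta (((f.natDegree : ℂ) + 2) * s₀ - 1) / ((f.natDegree : ℂ) + 1) *
    (taylorCoeffZero (polyCpow f (-s₀)) n + taylorCoeffZero (polyCpow f.reverse (-s₀)) n)

/-!
Write `d` for the degree of `f` and `g = f.reverse`. If `d = 0` the series is `f(0)^(-s) ζ(s)^2`,
which has no pole but `s = 1`. Let `d ≥ 1`.

*Convergence.* The base `n m^(d+1) f(n/m)` is bounded below by a constant times `(n m)^((d+2)/2)`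
(`exists_base_ge`), so the series converges absolutely, with a holomorphic sum, for
`Re s > 2/(d+2)`.

*Splitting.* A smooth cutoff with `cutoff u + cutoff (1/u) = 1` writes the series as a sum of two
half series (`zetaTerm_eq_halfTerm_add`), one for `p = g` and one for `p = f`, of the form
`∑_n n^(-(d+2)s) ∑_m u^(-s) p(u)^(-s) cutoff(u)` with `u = m/n`. The inner sum is a Riemann sum of
mesh `h = 1/n` of a function with compact support which is smooth except for the factor `u^(-s)`.

*Expansion of the inner sum.* With `c_k(s) = [x^k] p(x)^(-s)` and
`I(s) = ∫ u^(-s) p(u)^(-s) cutoff(u) du`, for `Re s < 1` the inner sum equals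
`h⁻¹ I(s) + ∑_{k<K+4} c_k(s) ζ(s-k) h^(k-s) + O(h^(K+1))`, locally uniformly in `s`
(`exists_cutErr_bound`). Subtracting the Taylor polynomial of `p^(-s)` leaves a function
vanishing at `0` to high order, whose Riemann sums are controlled by Poisson summation
(`VanishFam.exists_riemannSum_bound`). The powers `u^(k-s)` lead to the smoothly truncated zeta
series `∑_m m^(-z) cutoff(m h)`, which equals `h^(z-1) ∫ u^(-z) cutoff(u) du + ζ(z)` up to every
power of `h` (`exists_zetaCut_bound`). To see the latter without continuing the integral, one
combines the truncations at two scales as in the alternating zeta function. The main terms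
cancel, the dyadic increments are Riemann sums away from `0`, hence negligible, and the limit
`(1 - 2^(1-z)) ζ(z)` is identified for `Re z > 1` and extended by the identity theorem
(`tendsto_etaCut_dyadic`).

*Continuation.* Summing over `n`, the half series becomes
`ζ((d+2)s-1) I(s) + ∑_{k<K+4} c_k(s) ζ(s-k) ζ((d+1)s+k) + E(s)` (`halfExpansion`), where `E` is
holomorphic for `Re s < 1` and `(d+2) Re s + K > 0`. These formulas, for all `K`, agree with each
other and with the double series, which gives the continuation (`exists_isZetaContinuation`).

*Poles.* In `Re s < 1` the factors `I`, `c_k` and `ζ(s-k)` are holomorphic. So apart from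
`s = 2/(d+2)` the only possible poles are the solutions of `(d+1)s + n = 1`. At such a point `s₀`
only the `n`-th correction is singular, with residue `c_n(s₀) ζ(s₀-n)/(d+1)`, and
`s₀ - n = (d+2)s₀ - 1` (`tendsto_sub_mul_halfExpansion`). If `s₀` is an integer, then `s₀ = -j`
with `j ≥ 0`, `p^j` has degree at most `d j < n = 1 + (d+1) j`, and the residue is `0`
(`residueValue_eq_zero_of_int`). Any continuation agrees with the one constructed, off a discrete
set, by the identity theorem for meromorphic functions.
-/

/-! ### A quantitative Poisson summation formula -/

theorem HasCompactSupport.iteratedDeriv_real {f : ℝ → ℂ} (hc : HasCompactSupport f) (n : ℕ) :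
    HasCompactSupport (iteratedDeriv n f) := by
  induction n with
  | zero => simpa using hc
  | succ n ih => rw [iteratedDeriv_succ]; exact ih.deriv

open MeasureTheory FourierTransform in
theorem norm_fourier_mul_pow_le {f : ℝ → ℂ} {J : ℕ} (hf : ContDiff ℝ J f)
    (hc : HasCompactSupport f) (x : ℝ) :
    (2 * Real.pi * |x|) ^ J * ‖𝓕 f x‖ ≤ ∫ y, ‖iteratedDeriv J f y‖ := by
  have hint : ∀ n : ℕ, (n : ℕ∞) ≤ (J : ℕ∞) → Integrable (iteratedDeriv n f) := fun n hn =>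
    (hf.continuous_iteratedDeriv n (by exact_mod_cast hn)).integrable_of_hasCompactSupport
      (hc.iteratedDeriv_real n)
  have h := congrFun (Real.fourier_iteratedDeriv (N := (J : ℕ∞)) (by exact_mod_cast hf) hint
    le_rfl) x
  have h2 : ‖𝓕 (iteratedDeriv J f) x‖ ≤ ∫ y, ‖iteratedDeriv J f y‖ := by
    exact VectorFourier.norm_fourierIntegral_le_integral_norm Real.fourierChar volume
      (innerₗ ℝ) (iteratedDeriv J f) x
  rw [h, norm_smul, norm_pow] at h2
  have h3 : ‖2 * Real.pi * Complex.I * (x : ℂ)‖ = 2 * Real.pi * |x| := by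
    simp [abs_of_pos Real.pi_pos]
  rwa [h3] at h2

open MeasureTheory FourierTransform in
/-- A quantitative Poisson summation formula: for a compactly supported function of class `C^J`,
the sum over the integers differs from the integral by the nonzero Fourier modes, each of which is
controlled by the `L¹` norm of the `J`-th derivative. -/
theorem norm_tsum_int_sub_integral_le {f : ℝ → ℂ} {J : ℕ} (hJ : 2 ≤ J) (hf : ContDiff ℝ J f)
    (hc : HasCompactSupport f) :
    ‖∑' n : ℤ, f n - ∫ x, f x‖ ≤
      (∑' n : ℤ, |(n : ℝ)| ^ (-2 : ℝ)) * ∫ y, ‖iteratedDeriv J f y‖ := by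
  set M := ∫ y, ‖iteratedDeriv J f y‖ with hM
  have hM0 : 0 ≤ M := integral_nonneg fun _ => norm_nonneg _
  have hb : ∀ x : ℝ, 1 ≤ |x| → ‖𝓕 f x‖ ≤ |x| ^ (-2 : ℝ) * M := by
    intro x hx
    have h1 := norm_fourier_mul_pow_le hf hc x
    have h2 : |x| ^ 2 ≤ (2 * Real.pi * |x|) ^ J := by
      have : |x| ≤ 2 * Real.pi * |x| := by nlinarith [Real.pi_gt_three]
      calc |x| ^ 2 ≤ |x| ^ J := pow_le_pow_right₀ hx hJ
        _ ≤ _ := pow_le_pow_left₀ (abs_nonneg _) this _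
    have hx2 : 0 < |x| ^ 2 := by positivity
    rw [Real.rpow_neg (abs_nonneg _), Real.rpow_two, inv_mul_eq_div, le_div_iff₀ hx2, mul_comm]
    exact (mul_le_mul_of_nonneg_right h2 (norm_nonneg _)).trans h1
  have hsum : Summable fun n : ℤ => |(n : ℝ)| ^ (-2 : ℝ) * M :=
    (Real.summable_abs_int_rpow (by norm_num)).mul_right M
  have hbn : ∀ n : ℤ, n ≠ 0 → ‖𝓕 f (n : ℝ)‖ ≤ |(n : ℝ)| ^ (-2 : ℝ) * M := fun n hn =>
    hb n (by exact_mod_cast Int.one_le_abs hn)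
  have hFs : Summable fun n : ℤ => 𝓕 f (n : ℝ) := by
    refine Summable.of_norm_bounded_eventually hsum ?_
    have : ∀ᶠ n : ℤ in cofinite, n ≠ 0 := (Set.finite_singleton (0 : ℤ)).compl_mem_cofinite
    filter_upwards [this] with n hn using hbn n hn
  have hdec : f =O[cocompact ℝ] fun x : ℝ => |x| ^ (-2 : ℝ) := by
    have : f =ᶠ[cocompact ℝ] fun _ => 0 :=
      hasCompactSupport_iff_eventuallyEq.1 hc |>.filter_mono (cocompact_le_coclosedCompact)
    exact this.trans_isBigO (Asymptotics.isBigO_zero _ _)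
  have hP := Real.tsum_eq_tsum_fourier_of_rpow_decay_of_summable hf.continuous
    (by norm_num : (1 : ℝ) < 2) hdec hFs 0
  simp only [zero_add, QuotientAddGroup.mk_zero, fourier_eval_zero,
    mul_one] at hP
  have h0 : 𝓕 f ((0 : ℤ) : ℝ) = ∫ x, f x := by simp [Real.fourier_eq]
  rw [hP, hFs.tsum_eq_add_tsum_ite 0, h0, add_sub_cancel_left, ← tsum_mul_right]
  refine tsum_of_norm_bounded hsum.hasSum fun n => ?_
  split_ifs with h
  · rw [norm_zero]; positivity
  · exact hbn n h

open MeasureTheory in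
/-- The Poisson bound for sums over the lattice of mesh `h`: the error gains the factor
`h^(J-1)`. -/
theorem norm_tsum_int_mul_sub_integral_le {f : ℝ → ℂ} {J : ℕ} (hJ : 2 ≤ J) (hf : ContDiff ℝ J f)
    (hc : HasCompactSupport f) {h : ℝ} (hh : 0 < h) :
    ‖∑' n : ℤ, f (h * n) - (h : ℂ)⁻¹ * ∫ x, f x‖ ≤
      (∑' n : ℤ, |(n : ℝ)| ^ (-2 : ℝ)) * (h ^ J * h⁻¹ * ∫ y, ‖iteratedDeriv J f y‖) := by
  have h1 := norm_tsum_int_sub_integral_le hJ (f := fun x => f (h * x)) (by fun_prop)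
    (hc.comp_homeomorph (Homeomorph.mulLeft₀ h hh.ne'))
  have h2 : ∫ x, f (h * x) = (h : ℂ)⁻¹ * ∫ x, f x := by
    rw [Measure.integral_comp_mul_left f h, abs_of_pos (inv_pos.2 hh)]
    simp
  have h3 : ∫ y, ‖iteratedDeriv J (fun x => f (h * x)) y‖
      = h ^ J * h⁻¹ * ∫ y, ‖iteratedDeriv J f y‖ := by
    rw [iteratedDeriv_comp_const_smul hf h]
    simp only [norm_smul, norm_pow, Real.norm_eq_abs, abs_of_pos hh]
    rw [integral_const_mul, Measure.integral_comp_mul_left (fun y => ‖iteratedDeriv J f y‖) h,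
      abs_of_pos (inv_pos.2 hh), smul_eq_mul]
    ring
  rwa [h2, h3] at h1

/-! ### Riemann sums of families vanishing at the origin -/

/-- `VanishFam S J a w` says that the functions `w s` on `(0, ∞)`, for `s ∈ S`, vanish beyond `4`,
have `J` derivatives, and that the `j`-th derivative is `O(u^(a-j))`, uniformly in `s ∈ S`, for
every `j ≤ J`. -/
def VanishFam (S : Set ℂ) : ℕ → ℝ → (ℂ → ℝ → ℂ) → Prop
  | 0, a, w => (∃ C : ℝ, ∀ s ∈ S, ∀ u : ℝ, 0 < u → ‖w s u‖ ≤ C * u ^ a) ∧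
      ∀ s ∈ S, ∀ u : ℝ, 4 < u → w s u = 0
  | J + 1, a, w => ((∃ C : ℝ, ∀ s ∈ S, ∀ u : ℝ, 0 < u → ‖w s u‖ ≤ C * u ^ a) ∧
      ∀ s ∈ S, ∀ u : ℝ, 4 < u → w s u = 0) ∧
      ∃ w' : ℂ → ℝ → ℂ, (∀ s ∈ S, ∀ u : ℝ, 0 < u → HasDerivAt (w s) (w' s u) u) ∧
        VanishFam S J (a - 1) w'

namespace VanishFam

variable {S : Set ℂ} {J : ℕ} {a : ℝ} {w v : ℂ → ℝ → ℂ}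

theorem zeroth (h : VanishFam S J a w) : VanishFam S 0 a w := by
  cases J with
  | zero => exact h
  | succ J => exact h.1

theorem pred (h : VanishFam S (J + 1) a w) : VanishFam S J a w := by
  induction J generalizing a w with
  | zero => exact h.1
  | succ J ih =>
    obtain ⟨h0, w', hw', h'⟩ := h
    exact ⟨h0, w', hw', ih h'⟩

theorem of_le {J' : ℕ} (h : VanishFam S J a w) (hJ : J' ≤ J) : VanishFam S J' a w := by
  induction hJ with
  | refl => exact h
  | step _ ih => exact ih h.pred

theorem add (hw : VanishFam S J a w) (hv : VanishFam S J a v) :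
    VanishFam S J a (fun s u => w s u + v s u) := by
  induction J generalizing a w v with
  | zero =>
    obtain ⟨⟨C, hC⟩, hw⟩ := hw
    obtain ⟨⟨D, hD⟩, hv⟩ := hv
    refine ⟨⟨C + D, fun s hs u hu => ?_⟩, fun s hs u hu => by simp [hw s hs u hu, hv s hs u hu]⟩
    rw [add_mul]
    exact (norm_add_le _ _).trans (add_le_add (hC s hs u hu) (hD s hs u hu))
  | succ J ih =>
    have h0 := ih hw.pred hv.pred
    obtain ⟨-, w', hw', hfw⟩ := hw
    obtain ⟨-, v', hv', hfv⟩ := hv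
    exact ⟨h0.zeroth, _, fun s hs u hu => (hw' s hs u hu).add (hv' s hs u hu), ih hfw hfv⟩

theorem mul_left {c : ℂ → ℂ} {B : ℝ} (hc : ∀ s ∈ S, ‖c s‖ ≤ B) (hw : VanishFam S J a w) :
    VanishFam S J a (fun s u => c s * w s u) := by
  induction J generalizing a w with
  | zero =>
    obtain ⟨⟨C, hC⟩, hw⟩ := hw
    refine ⟨⟨B * C, fun s hs u hu => ?_⟩, fun s hs u hu => by simp [hw s hs u hu]⟩
    rw [norm_mul, mul_assoc]
    exact mul_le_mul (hc s hs) (hC s hs u hu) (norm_nonneg _) ((norm_nonneg _).trans (hc s hs))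
  | succ J ih =>
    have h0 := ih hw.pred
    obtain ⟨-, w', hw', hfw⟩ := hw
    exact ⟨h0.zeroth, _, fun s hs u hu => (hw' s hs u hu).const_mul _, ih hfw⟩

/-- Division by `u`; the quotient rule brings in the families `w' / u` and `w / u^2`. -/
theorem div_id (hw : VanishFam S J a w) : VanishFam S J (a - 1) (fun s u => w s u / (u : ℂ)) := by
  induction J generalizing a w with
  | zero =>
    obtain ⟨⟨C, hC⟩, hw⟩ := hw
    refine ⟨⟨C, fun s hs u hu => ?_⟩, fun s hs u hu => by simp [hw s hs u hu]⟩
    rw [norm_div, Complex.norm_real, Real.norm_of_nonneg hu.le, Real.rpow_sub_one hu.ne',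
      ← mul_div_assoc]
    exact div_le_div_of_nonneg_right (hC s hs u hu) hu.le
  | succ J ih =>
    have h0 := ih hw.pred
    obtain ⟨-, w', hw', hfw⟩ := id hw
    refine ⟨h0.zeroth, fun s u => w' s u / u + (-1) * (w s u / u / u), fun s hs u hu => ?_,
      (ih hfw).add ((ih (ih hw.pred)).mul_left (B := 1) (c := fun _ => -1) (by simp))⟩
    have hu' : (u : ℂ) ≠ 0 := by exact_mod_cast hu.ne'
    have h1 : HasDerivAt (fun u : ℝ => (u : ℂ)) 1 u := Complex.ofRealCLM.hasDerivAt
    refine ((hw' s hs u hu).div h1 hu').congr_deriv ?_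
    field_simp
    ring

/-- Multiplication by `u^(-s)` lowers the order of vanishing at `0` by any upper bound
of `Re s`. -/
theorem cpow_mul {B σ : ℝ} (hB : ∀ s ∈ S, ‖s‖ ≤ B) (hσ : ∀ s ∈ S, s.re ≤ σ)
    (hw : VanishFam S J a w) :
    VanishFam S J (a - σ) (fun s u => (u : ℂ) ^ (-s) * w s u) := by
  induction J generalizing a w with
  | zero =>
    obtain ⟨⟨C, hC⟩, hw⟩ := hw
    refine ⟨⟨4 ^ (|σ| + B) * |C|, fun s hs u hu => ?_⟩, fun s hs u hu => by simp [hw s hs u hu]⟩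
    have hr : 0 ≤ 4 ^ (|σ| + B) * |C| * u ^ (a - σ) := by positivity
    rcases lt_or_ge 4 u with h4 | h4
    · simpa [hw s hs u h4] using hr
    rw [norm_mul, Complex.norm_cpow_eq_rpow_re_of_pos hu, Complex.neg_re]
    have hs1 : -B ≤ s.re :=
      (neg_le_neg (hB s hs)).trans (neg_le_of_abs_le (Complex.abs_re_le_norm s))
    have h1 : u ^ (-s.re) ≤ 4 ^ (|σ| + B) * u ^ (-σ) := by
      have : u ^ (-s.re) = u ^ (σ - s.re) * u ^ (-σ) := by rw [← Real.rpow_add hu]; ring_nf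
      rw [this]
      refine mul_le_mul_of_nonneg_right ?_ (by positivity)
      calc u ^ (σ - s.re) ≤ 4 ^ (σ - s.re) :=
            Real.rpow_le_rpow hu.le h4 (by linarith [hσ s hs])
        _ ≤ _ := Real.rpow_le_rpow_of_exponent_le (by norm_num) (by linarith [le_abs_self σ])
    calc u ^ (-s.re) * ‖w s u‖ ≤ (4 ^ (|σ| + B) * u ^ (-σ)) * (|C| * u ^ a) :=
          mul_le_mul h1 ((hC s hs u hu).trans
            (mul_le_mul_of_nonneg_right (le_abs_self C) (by positivity)))
            (norm_nonneg _) (by positivity)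
      _ = _ := by rw [sub_eq_neg_add, Real.rpow_add hu]; ring
  | succ J ih =>
    have h0 := ih hw.pred
    obtain ⟨-, w', hw', hfw⟩ := id hw
    refine ⟨h0.zeroth, fun s u => (u : ℂ) ^ (-s) * (w' s u + (-s) * (w s u / u)),
      fun s hs u hu => ?_, ?_⟩
    · have hu' : (u : ℂ) ≠ 0 := by exact_mod_cast hu.ne'
      have h1 : HasDerivAt (fun u : ℝ => (u : ℂ) ^ (-s)) (-s * (u : ℂ) ^ (-s - 1)) u :=
        (hasDerivAt_id (u : ℂ)).cpow_const (Or.inl (by simpa using hu)) |>.comp_ofReal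
          |>.congr_deriv (by simp)
      refine (h1.mul (hw' s hs u hu)).congr_deriv ?_
      rw [Complex.cpow_sub _ _ hu', Complex.cpow_one]
      ring
    · have := ih (hfw.add (hw.pred.div_id.mul_left (c := fun s => -s) (B := B) (by simpa using hB)))
      rwa [show a - 1 - σ = a - σ - 1 by ring] at this

/-- A family vanishing at `0` to order `a > 1` remains differentiable at `0` when it is extended
by zero to the negative half-line. -/
theorem hasDerivAt_indicator {w' : ℂ → ℝ → ℂ} (hw : VanishFam S 0 a w) (ha : 1 < a)
    (hd : ∀ s ∈ S, ∀ u : ℝ, 0 < u → HasDerivAt (w s) (w' s u) u) {s : ℂ} (hs : s ∈ S) (u : ℝ) :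
    HasDerivAt ((Set.Ioi (0 : ℝ)).indicator (w s)) ((Set.Ioi (0 : ℝ)).indicator (w' s) u) u := by
  rcases lt_trichotomy u 0 with hu | rfl | hu
  · rw [Set.indicator_of_notMem (by simpa using hu.le)]
    refine (hasDerivAt_const u (0 : ℂ)).congr_of_eventuallyEq ?_
    filter_upwards [Iio_mem_nhds hu] with x hx
    exact Set.indicator_of_notMem (by simpa using (le_of_lt hx)) _
  · rw [Set.indicator_of_notMem (by simp)]
    obtain ⟨⟨C, hC⟩, -⟩ := hw
    rw [hasDerivAt_iff_isLittleO]
    have h0 : (Set.Ioi (0 : ℝ)).indicator (w s) 0 = 0 := Set.indicator_of_notMem (by simp) _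
    simp only [h0, sub_zero, smul_zero]
    have hO : (Set.Ioi (0 : ℝ)).indicator (w s) =O[𝓝 0] fun u : ℝ => |u| ^ a := by
      refine Asymptotics.IsBigO.of_bound |C| (Eventually.of_forall fun u => ?_)
      by_cases hu : 0 < u
      · rw [Set.indicator_of_mem (by simpa using hu), Real.norm_of_nonneg (by positivity),
          abs_of_pos hu]
        exact (hC s hs u hu).trans (mul_le_mul_of_nonneg_right (le_abs_self C) (by positivity))
      · rw [Set.indicator_of_notMem (by simpa using hu), norm_zero]
        positivity
    refine hO.trans_isLittleO ?_
    refine Asymptotics.isLittleO_of_tendsto (fun x hx => by simp [hx, (by linarith : a ≠ 0)]) ?_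
    rw [tendsto_zero_iff_norm_tendsto_zero]
    have hlim : Tendsto (fun x : ℝ => |x| ^ (a - 1)) (𝓝 0) (𝓝 0) := by
      have : Tendsto (fun x : ℝ => |x| ^ (a - 1)) (𝓝 0) (𝓝 (|0| ^ (a - 1))) :=
        ((continuous_abs.tendsto (0 : ℝ)).rpow_const (Or.inr (by linarith)))
      simpa [Real.zero_rpow (by linarith : a - 1 ≠ 0)] using this
    refine hlim.congr fun x => ?_
    rcases eq_or_ne x 0 with rfl | hx
    · simp [Real.zero_rpow (by linarith : a - 1 ≠ 0)]
    · rw [norm_div, Real.norm_of_nonneg (by positivity), Real.norm_eq_abs,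
        Real.rpow_sub_one (abs_ne_zero.2 hx)]
  · rw [Set.indicator_of_mem (by simpa using hu)]
    refine (hd s hs u hu).congr_of_eventuallyEq ?_
    filter_upwards [Ioi_mem_nhds hu] with x hx
    exact Set.indicator_of_mem hx _

theorem bound_indicator (hw : VanishFam S 0 a w) (ha : 0 ≤ a) :
    ∃ C : ℝ, ∀ s ∈ S, ∀ u, ‖(Set.Ioi (0 : ℝ)).indicator (w s) u‖
      ≤ (Set.Icc (0 : ℝ) 4).indicator (fun _ => C) u := by
  obtain ⟨⟨C, hC⟩, h4⟩ := hw
  refine ⟨|C| * 4 ^ a, fun s hs u => ?_⟩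
  have hp : ∀ u, 0 ≤ (Set.Icc (0 : ℝ) 4).indicator (fun _ => |C| * 4 ^ a) u :=
    fun u => Set.indicator_nonneg (fun _ _ => by positivity) u
  by_cases hu : 0 < u
  · rw [Set.indicator_of_mem (by simpa using hu)]
    rcases lt_or_ge 4 u with h | h
    · simpa [h4 s hs u h] using hp u
    · rw [Set.indicator_of_mem (Set.mem_Icc.2 ⟨hu.le, h⟩)]
      refine (hC s hs u hu).trans ?_
      exact mul_le_mul (le_abs_self C) (Real.rpow_le_rpow hu.le h ha) (by positivity) (abs_nonneg _)
  · rw [Set.indicator_of_notMem (by simpa using hu), norm_zero]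
    exact hp u

/-- Extended by zero to the negative half-line, a family vanishing to order `a > J` at `0` is of
class `C^J`, with uniformly bounded `J`-th derivatives. -/
theorem contDiff_indicator (hw : VanishFam S (J + 1) a w) (ha : (J : ℝ) < a) :
    (∀ s ∈ S, ContDiff ℝ J ((Set.Ioi (0 : ℝ)).indicator (w s))) ∧
    ∃ C : ℝ, ∀ s ∈ S, ∀ u, ‖iteratedDeriv J ((Set.Ioi (0 : ℝ)).indicator (w s)) u‖
      ≤ (Set.Icc (0 : ℝ) 4).indicator (fun _ => C) u := by
  induction J generalizing a w with
  | zero =>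
    simp only [Nat.cast_zero] at ha
    have h0 : VanishFam S 0 a w := hw.zeroth
    obtain ⟨-, w', hd, -⟩ := hw
    refine ⟨fun s hs => ?_, by simpa using h0.bound_indicator ha.le⟩
    rw [Nat.cast_zero, contDiff_zero, continuous_iff_continuousAt]
    intro u
    rcases lt_trichotomy u 0 with hu | rfl | hu
    · refine (continuousAt_const (y := (0 : ℂ))).congr ?_
      filter_upwards [Iio_mem_nhds hu] with x hx
      exact (Set.indicator_of_notMem (by simpa using (le_of_lt hx)) _).symm
    · obtain ⟨⟨C, hC⟩, -⟩ := h0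
      have hz : (Set.Ioi (0 : ℝ)).indicator (w s) 0 = 0 := Set.indicator_of_notMem (by simp) _
      rw [ContinuousAt, hz]
      have hlim : Tendsto (fun x : ℝ => |C| * |x| ^ a) (𝓝 0) (𝓝 0) := by
        have : Tendsto (fun x : ℝ => |C| * |x| ^ a) (𝓝 0) (𝓝 (|C| * |0| ^ a)) :=
          ((continuous_abs.tendsto (0 : ℝ)).rpow_const (Or.inr ha.le)).const_mul _
        simpa [Real.zero_rpow ha.ne'] using this
      refine squeeze_zero_norm (fun u => ?_) hlim
      by_cases hu : 0 < u
      · rw [Set.indicator_of_mem (by simpa using hu), abs_of_pos hu]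
        exact (hC s hs u hu).trans (mul_le_mul_of_nonneg_right (le_abs_self C) (by positivity))
      · rw [Set.indicator_of_notMem (by simpa using hu), norm_zero]
        positivity
    · refine (hd s hs u hu).continuousAt.congr ?_
      filter_upwards [Ioi_mem_nhds hu] with x hx
      exact (Set.indicator_of_mem hx _).symm
  | succ J ih =>
    push_cast at ha
    have h0 : VanishFam S 0 a w := hw.zeroth
    obtain ⟨-, w', hd, hw'⟩ := hw
    obtain ⟨ih1, C, hC⟩ := ih hw' (by linarith)
    have hder : ∀ s ∈ S, deriv ((Set.Ioi (0 : ℝ)).indicator (w s)) =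
        (Set.Ioi (0 : ℝ)).indicator (w' s) := fun s hs => funext fun u =>
      (h0.hasDerivAt_indicator (by linarith [(Nat.cast_nonneg J : (0 : ℝ) ≤ J)]) hd hs u).deriv
    refine ⟨fun s hs => ?_, C, fun s hs u => ?_⟩
    · rw [Nat.cast_add, Nat.cast_one, contDiff_succ_iff_deriv]
      refine ⟨fun u => (h0.hasDerivAt_indicator
        (by linarith [(Nat.cast_nonneg J : (0 : ℝ) ≤ J)]) hd hs u).differentiableAt,
        fun h => by simp at h, ?_⟩
      rw [hder s hs]
      exact ih1 s hs
    · rw [iteratedDeriv_succ', hder s hs]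
      exact hC s hs u

open MeasureTheory in
/-- The Riemann sums of a family vanishing at `0` to high order converge to the integrals at the
rate of a high power of the mesh, uniformly in the family. -/
theorem exists_riemannSum_bound (hw : VanishFam S (J + 1) a w) (ha : (J : ℝ) < a) (hJ : 2 ≤ J) :
    ∃ C : ℝ, 0 ≤ C ∧ ∀ s ∈ S, ∀ h : ℝ, 0 < h →
      ‖∑' m : ℕ+, w s (m * h) - (h : ℂ)⁻¹ * ∫ u in Set.Ioi (0 : ℝ), w s u‖ ≤ C * (h ^ J * h⁻¹) := by
  obtain ⟨hcd, C, hC⟩ := hw.contDiff_indicator ha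
  set T := ∑' n : ℤ, |(n : ℝ)| ^ (-2 : ℝ) with hT
  have hT0 : 0 ≤ T := tsum_nonneg fun n => by positivity
  refine ⟨T * (4 * |C|), by positivity, fun s hs h hh => ?_⟩
  have hcs : HasCompactSupport ((Set.Ioi (0 : ℝ)).indicator (w s)) := by
    refine HasCompactSupport.of_support_subset_isCompact (isCompact_Icc (a := (0 : ℝ)) (b := 4)) ?_
    intro u hu
    rw [Function.mem_support] at hu
    by_contra hu2
    apply hu
    by_cases h0 : 0 < u
    · rw [Set.indicator_of_mem (by simpa using h0)]
      refine hw.zeroth.2 s hs u ?_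
      by_contra h4
      exact hu2 ⟨h0.le, not_lt.1 h4⟩
    · exact Set.indicator_of_notMem (by simpa using h0) _
  have h1 := norm_tsum_int_mul_sub_integral_le hJ (hcd s hs) hcs hh
  have h2 : ∑' n : ℤ, (Set.Ioi (0 : ℝ)).indicator (w s) (h * n) = ∑' m : ℕ+, w s (m * h) := by
    have hinj : Function.Injective (fun m : ℕ+ => ((m : ℕ) : ℤ)) := fun m n hmn =>
      PNat.eq (Int.ofNat_inj.1 hmn)
    rw [← hinj.tsum_eq]
    · refine tsum_congr fun m => ?_
      have : 0 < h * (((m : ℕ) : ℤ) : ℝ) := by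
        have : (0 : ℝ) < (m : ℕ) := by exact_mod_cast m.pos
        push_cast; positivity
      rw [Set.indicator_of_mem (by simpa using this)]
      push_cast
      rw [mul_comm]
    · intro n hn
      rw [Function.mem_support] at hn
      have hpos : 0 < h * n := by
        by_contra h0
        exact hn (Set.indicator_of_notMem (by simpa using h0) _)
      have hn0 : (0 : ℝ) < n := (pos_iff_pos_of_mul_pos hpos).1 hh
      have hn1 : 0 < n := by exact_mod_cast hn0
      refine ⟨⟨n.toNat, by omega⟩, ?_⟩
      simpa using hn1.le
  rw [h2, integral_indicator measurableSet_Ioi] at h1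
  refine h1.trans ?_
  rw [mul_assoc T]
  refine mul_le_mul_of_nonneg_left ?_ hT0
  rw [mul_comm]
  refine mul_le_mul_of_nonneg_right ?_ (by positivity)
  calc ∫ y, ‖iteratedDeriv J ((Set.Ioi (0 : ℝ)).indicator (w s)) y‖
      ≤ ∫ y, (Set.Icc (0 : ℝ) 4).indicator (fun _ => C) y := by
        refine integral_mono_of_nonneg (Eventually.of_forall fun _ => norm_nonneg _) ?_
          (Eventually.of_forall fun y => hC s hs y)
        exact (integrable_indicator_iff measurableSet_Icc).2 (by simp)
    _ = 4 * C := by rw [integral_indicator measurableSet_Icc]; simp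
    _ ≤ _ := by gcongr; exact le_abs_self C

end VanishFam

/-! ### Taylor bounds for smooth families -/

/-- The partial derivative, over `𝕜`, of a function on `ℂ × 𝕜` with respect to the second
variable. -/
noncomputable def partialSnd (𝕜 : Type*) [NontriviallyNormedField 𝕜] [NormedSpace 𝕜 ℂ]
    (w : ℂ × 𝕜 → ℂ) : ℂ × 𝕜 → ℂ :=
  fun q => fderiv 𝕜 w q (0, 1)

section partialSnd

variable {𝕜 : Type*} [NontriviallyNormedField 𝕜] [NormedSpace 𝕜 ℂ] {w : ℂ × 𝕜 → ℂ}
  {U : Set (ℂ × 𝕜)}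

theorem ContDiffOn.partialSnd (hU : IsOpen U) (hw : ContDiffOn 𝕜 (⊤ : ℕ∞) w U) :
    ContDiffOn 𝕜 (⊤ : ℕ∞) (partialSnd 𝕜 w) U :=
  (hw.fderiv_of_isOpen hU (m := (⊤ : ℕ∞)) (by simp)).clm_apply contDiffOn_const

theorem ContDiffOn.partialSnd_iterate (hU : IsOpen U) (hw : ContDiffOn 𝕜 (⊤ : ℕ∞) w U) (k : ℕ) :
    ContDiffOn 𝕜 (⊤ : ℕ∞) ((_root_.partialSnd 𝕜)^[k] w) U := by
  induction k with
  | zero => exact hw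
  | succ k ih => rw [Function.iterate_succ_apply']; exact ih.partialSnd hU

theorem ContDiffOn.hasDerivAt_partialSnd (hU : IsOpen U) (hw : ContDiffOn 𝕜 (⊤ : ℕ∞) w U)
    {s : ℂ} {u : 𝕜} (hu : (s, u) ∈ U) :
    HasDerivAt (fun u => w (s, u)) (_root_.partialSnd 𝕜 w (s, u)) u := by
  have h1 : HasFDerivAt w (fderiv 𝕜 w (s, u)) (s, u) :=
    ((hw.differentiableOn (by simp)).differentiableAt (hU.mem_nhds hu)).hasFDerivAt
  have h2 : HasDerivAt (fun u : 𝕜 => (s, u)) (0, 1) u :=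
    (hasDerivAt_const u s).prodMk (hasDerivAt_id u)
  exact h1.comp_hasDerivAt u h2

theorem ContDiffOn.partialSnd_iterate_eq_iteratedDeriv (hU : IsOpen U)
    (hw : ContDiffOn 𝕜 (⊤ : ℕ∞) w U) (k : ℕ) {s : ℂ} {u : 𝕜} (hu : (s, u) ∈ U) :
    (_root_.partialSnd 𝕜)^[k] w (s, u) = iteratedDeriv k (fun u => w (s, u)) u := by
  induction k generalizing u with
  | zero => simp
  | succ k ih =>
    rw [Function.iterate_succ_apply', iteratedDeriv_succ]
    rw [← ((hw.partialSnd_iterate hU k).hasDerivAt_partialSnd hU hu).deriv]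
    refine Filter.EventuallyEq.deriv_eq ?_
    have hc : Tendsto (fun u : 𝕜 => (s, u)) (𝓝 u) (𝓝 (s, u)) :=
      (Continuous.prodMk_right s).tendsto u
    filter_upwards [hc (hU.mem_nhds hu)] with x hx using ih hx

end partialSnd

/-- Taylor's bound with a parameter: a smooth family whose derivatives of order less than `K`
vanish at `u = 0` is `O(u^K)`, uniformly in the parameter. -/
theorem exists_norm_le_pow_of_partialSnd_eq_zero {O : Set ℝ} (hO : IsOpen O)
    (h0 : Set.Ici 0 ⊆ O) {S : Set ℂ} (hS : IsCompact S) {K : ℕ} {w : ℂ × ℝ → ℂ}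
    (hw : ContDiffOn ℝ (⊤ : ℕ∞) w (Set.univ ×ˢ O))
    (hz : ∀ i < K, ∀ s ∈ S, (partialSnd ℝ)^[i] w (s, 0) = 0) :
    ∃ C : ℝ, 0 ≤ C ∧ ∀ s ∈ S, ∀ u ∈ Set.Icc (0 : ℝ) 4, ‖w (s, u)‖ ≤ C * u ^ K := by
  have hU : IsOpen ((Set.univ : Set ℂ) ×ˢ O) := isOpen_univ.prod hO
  induction K generalizing w with
  | zero =>
    obtain ⟨C, hC⟩ := (hS.prod (isCompact_Icc (a := (0 : ℝ)) (b := 4))).exists_bound_of_continuousOn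
      (hw.continuousOn.mono (Set.prod_mono (Set.subset_univ S)
        (Set.Icc_subset_Ici_self.trans h0)))
    refine ⟨|C|, abs_nonneg _, fun s hs u hu => ?_⟩
    simpa using (hC (s, u) ⟨hs, hu⟩).trans (le_abs_self C)
  | succ K ih =>
    obtain ⟨C, hC0, hC⟩ := ih (hw.partialSnd hU) fun i hi s hs => by
      rw [← Function.iterate_succ_apply]
      exact hz (i + 1) (by omega) s hs
    refine ⟨C, hC0, fun s hs u hu => ?_⟩
    have h1 := (convex_Icc (0 : ℝ) u).norm_image_sub_le_of_norm_hasDerivWithin_le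
      (f := fun u => w (s, u)) (f' := fun u => partialSnd ℝ w (s, u)) (C := C * u ^ K)
      (x := 0) (y := u) (fun x hx => (hw.hasDerivAt_partialSnd hU
        ⟨Set.mem_univ s, h0 hx.1⟩).hasDerivWithinAt)
      (fun x hx => (hC s hs x ⟨hx.1, hx.2.trans hu.2⟩).trans
        (mul_le_mul_of_nonneg_left (pow_le_pow_left₀ hx.1 hx.2 K) hC0))
      (Set.left_mem_Icc.2 hu.1) (Set.right_mem_Icc.2 hu.1)
    have h2 : w (s, 0) = 0 := hz 0 (by omega) s hs
    simp only [h2, sub_zero, Real.norm_of_nonneg hu.1] at h1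
    rwa [pow_succ, ← mul_assoc]

/-- A smooth family which is flat at `u = 0` to order `K` has `j`-th derivatives of size
`O(u^(K-j))` there, for `j ≤ K`. -/
theorem VanishFam.of_contDiffOn {O : Set ℝ} (hO : IsOpen O)
    (h0 : Set.Ici 0 ⊆ O) {S : Set ℂ} (hS : IsCompact S) {K : ℕ} {w : ℂ × ℝ → ℂ}
    (hw : ContDiffOn ℝ (⊤ : ℕ∞) w (Set.univ ×ˢ O))
    (hz : ∀ i < K, ∀ s ∈ S, (partialSnd ℝ)^[i] w (s, 0) = 0)
    (h4 : ∀ s, ∀ u : ℝ, 4 < u → w (s, u) = 0) :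
    VanishFam S K K (fun s u => w (s, u)) := by
  have hU : IsOpen ((Set.univ : Set ℂ) ×ˢ O) := isOpen_univ.prod hO
  have key : ∀ {K : ℕ} {w : ℂ × ℝ → ℂ}, ContDiffOn ℝ (⊤ : ℕ∞) w (Set.univ ×ˢ O) →
      (∀ i < K, ∀ s ∈ S, (partialSnd ℝ)^[i] w (s, 0) = 0) →
      (∀ s, ∀ u : ℝ, 4 < u → w (s, u) = 0) → VanishFam S 0 K (fun s u => w (s, u)) := by
    intro K w hw hz h4
    obtain ⟨C, hC0, hC⟩ := exists_norm_le_pow_of_partialSnd_eq_zero hO h0 hS hw hz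
    refine ⟨⟨C, fun s hs u hu => ?_⟩, fun s _ => h4 s⟩
    rcases lt_or_ge 4 u with h | h
    · simp only [h4 s u h, norm_zero]; positivity
    · rw [Real.rpow_natCast]
      exact hC s hs u ⟨hu.le, h⟩
  induction K generalizing w with
  | zero => exact key hw hz h4
  | succ K ih =>
    refine ⟨key hw hz h4, fun s u => partialSnd ℝ w (s, u), fun s hs u hu =>
      hw.hasDerivAt_partialSnd hU ⟨Set.mem_univ s, h0 hu.le⟩, ?_⟩
    rw [Nat.cast_add, Nat.cast_one, add_sub_cancel_right]
    refine ih (hw.partialSnd hU) (fun i hi s hs => ?_) fun s u hu => ?_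
    · rw [← Function.iterate_succ_apply]
      exact hz (i + 1) (by omega) s hs
    · have h1 := (hw.hasDerivAt_partialSnd hU (s := s) (u := u)
        ⟨Set.mem_univ s, h0 (by simp; linarith)⟩).deriv
      rw [← h1]
      have : (fun u => w (s, u)) =ᶠ[𝓝 u] fun _ => 0 := by
        filter_upwards [Ioi_mem_nhds hu] with x hx using h4 s x hx
      rw [this.deriv_eq, deriv_const]

/-! ### The cutoff function -/

/-- A cutoff on `[0, ∞)`, equal to `1` on `[0, 1/2]` and to `0` on `[2, ∞)`, and satisfying
`cutoff u + cutoff (1 / u) = 1`. -/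
noncomputable def cutoff (u : ℝ) : ℝ := Real.smoothTransition ((2 - u) / (1 + u))

theorem cutoff_nonneg (u : ℝ) : 0 ≤ cutoff u := Real.smoothTransition.nonneg _

theorem cutoff_le_one (u : ℝ) : cutoff u ≤ 1 := Real.smoothTransition.le_one _

theorem cutoff_eq_one {u : ℝ} (h0 : -1 < u) (h : u ≤ 1 / 2) : cutoff u = 1 := by
  refine Real.smoothTransition.one_of_one_le ?_
  rw [le_div_iff₀ (by linarith)]
  linarith

theorem cutoff_eq_zero {u : ℝ} (h : 2 ≤ u) : cutoff u = 0 :=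
  Real.smoothTransition.zero_of_nonpos (div_nonpos_of_nonpos_of_nonneg (by linarith) (by linarith))

theorem cutoff_add_cutoff_inv {u v : ℝ} (hu : 0 < u) (h : u * v = 1) :
    cutoff u + cutoff v = 1 := by
  obtain rfl : v = 1 / u := by field_simp; linarith
  have h1 : (2 - 1 / u) / (1 + 1 / u) = 1 - (2 - u) / (1 + u) := by
    field_simp
    ring
  simp only [cutoff]
  rw [h1]
  have h2 := Real.smoothTransition.pos_denom ((2 - u) / (1 + u))
  simp only [Real.smoothTransition, sub_sub_cancel]
  rw [add_comm (expNegInvGlue (1 - _)), ← add_div, div_self h2.ne']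

theorem contDiffOn_cutoff : ContDiffOn ℝ (⊤ : ℕ∞) cutoff (Set.Ioi (-1)) := by
  refine Real.smoothTransition.contDiff.comp_contDiffOn ?_
  refine (contDiffOn_const.sub contDiffOn_id).div (contDiffOn_const.add contDiffOn_id) ?_
  intro x hx
  exact (by linarith [Set.mem_Ioi.1 hx] : (0 : ℝ) < 1 + x).ne'

/-! ### Riemann sums and the zeta function -/

theorem finite_setOf_pnat_mul_lt {h : ℝ} (hh : 0 < h) : {m : ℕ+ | (m : ℝ) * h < 2}.Finite := by
  refine (Set.finite_Iic (Nat.succPNat ⌈2 / h⌉₊)).subset fun m (hm : (m : ℝ) * h < 2) => ?_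
  rw [← lt_div_iff₀ hh] at hm
  have h1 : (m : ℝ) ≤ ⌈2 / h⌉₊ := hm.le.trans (Nat.le_ceil _)
  have h2 : (m : ℕ) ≤ ⌈2 / h⌉₊ := by exact_mod_cast h1
  exact PNat.coe_le_coe _ _ |>.1 (by simpa using h2.trans (Nat.le_succ _))

theorem mul_cutoff_eq_zero {h : ℝ} (hh : 0 < h) (g : ℕ+ → ℂ) :
    ∀ m ∉ (finite_setOf_pnat_mul_lt hh).toFinset, g m * (cutoff (m * h) : ℂ) = 0 := by
  intro m hm
  simp only [Set.Finite.mem_toFinset, Set.mem_ofPred_eq, not_lt] at hm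
  rw [cutoff_eq_zero hm]
  simp

theorem summable_mul_cutoff {h : ℝ} (hh : 0 < h) (g : ℕ+ → ℂ) :
    Summable fun m : ℕ+ => g m * (cutoff (m * h) : ℂ) :=
  summable_of_ne_finset_zero (mul_cutoff_eq_zero hh g)

theorem tsum_mul_cutoff_eq_sum {h : ℝ} (hh : 0 < h) (g : ℕ+ → ℂ) :
    ∑' m : ℕ+, g m * (cutoff (m * h) : ℂ) =
      ∑ m ∈ (finite_setOf_pnat_mul_lt hh).toFinset, g m * (cutoff (m * h) : ℂ) :=
  tsum_eq_sum (mul_cutoff_eq_zero hh g)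

theorem hasSum_pnat_cpow_neg {z : ℂ} (hz : 1 < z.re) :
    HasSum (fun m : ℕ+ => (m : ℂ) ^ (-z)) (riemannZeta z) := by
  have h1 : Summable fun n : ℕ => ((n + 1 : ℕ) : ℂ) ^ (-z) := by
    have := (summable_nat_add_iff 1).2 (Complex.summable_one_div_nat_cpow.2 hz)
    simpa [Complex.cpow_neg] using this
  have h2 : HasSum (fun n : ℕ => ((n + 1 : ℕ) : ℂ) ^ (-z)) (riemannZeta z) := by
    rw [zeta_eq_tsum_one_div_nat_add_one_cpow hz]
    convert h1.hasSum using 3 with n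
    rw [Complex.cpow_neg, one_div]
    push_cast
    rfl
  rw [← Equiv.pnatEquivNat.symm.hasSum_iff]
  exact h2

/-- The Dirichlet series of the zeta function, smoothly truncated at height `1 / h`. -/
noncomputable def zetaCut (h : ℝ) (z : ℂ) : ℂ :=
  ∑' m : ℕ+, (m : ℂ) ^ (-z) * (cutoff (m * h) : ℂ)

theorem differentiable_zetaCut {h : ℝ} (hh : 0 < h) : Differentiable ℂ (zetaCut h) := by
  have : zetaCut h = fun z => ∑ m ∈ (finite_setOf_pnat_mul_lt hh).toFinset,
      (m : ℂ) ^ (-z) * (cutoff (m * h) : ℂ) := funext fun z => tsum_mul_cutoff_eq_sum hh _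
  rw [this]
  refine Differentiable.fun_sum fun m _ => ?_
  have hm : (m : ℂ) ≠ 0 := by exact_mod_cast m.ne_zero
  exact (differentiable_id.neg.const_cpow (Or.inl hm)).mul_const _

theorem tendsto_zetaCut {z : ℂ} (hz : 1 < z.re) :
    Tendsto (fun h => zetaCut h z) (𝓝[>] 0) (𝓝 (riemannZeta z)) := by
  have hs := hasSum_pnat_cpow_neg hz
  rw [← hs.tsum_eq]
  refine tendsto_tsum_of_dominated_convergence hs.summable.norm (fun m => ?_) ?_
  · refine tendsto_const_nhds.congr' ?_
    have hm : (0 : ℝ) < m := by exact_mod_cast m.pos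
    have h1 : Set.Ioo (0 : ℝ) (1 / 2 / m) ∈ 𝓝[>] (0 : ℝ) := Ioo_mem_nhdsGT (by positivity)
    filter_upwards [h1] with h hh
    have h2 : (m : ℝ) * h < 1 / 2 := by
      have := (lt_div_iff₀ hm).1 hh.2
      linarith
    have h3 : 0 < (m : ℝ) * h := mul_pos hm hh.1
    rw [cutoff_eq_one (by linarith) h2.le]
    simp
  · refine Eventually.of_forall fun h m => ?_
    rw [norm_mul, Complex.norm_real, Real.norm_of_nonneg (cutoff_nonneg _)]
    exact mul_le_of_le_one_right (norm_nonneg _) (cutoff_le_one _)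

/-- The difference of two dilates of the cutoff vanishes near `0`, hence to every order. -/
theorem vanishFam_cutoff_sub {S : Set ℂ} (hS : IsCompact S) (K : ℕ) :
    VanishFam S K K (fun _ u => ((cutoff (u / 2) - cutoff u : ℝ) : ℂ)) := by
  have hO : IsOpen (Set.Ioi (-1 : ℝ)) := isOpen_Ioi
  have hU : IsOpen ((Set.univ : Set ℂ) ×ˢ Set.Ioi (-1 : ℝ)) := isOpen_univ.prod hO
  have hmem : ((Set.univ : Set ℂ) ×ˢ Set.Ioi (-1 : ℝ)).MapsTo Prod.snd (Set.Ioi (-1 : ℝ)) :=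
    fun q hq => hq.2
  have hsm : ContDiffOn ℝ (⊤ : ℕ∞)
      (fun q : ℂ × ℝ => ((cutoff (q.2 / 2) - cutoff q.2 : ℝ) : ℂ)) (Set.univ ×ˢ Set.Ioi (-1)) := by
    refine Complex.ofRealCLM.contDiff.comp_contDiffOn (ContDiffOn.sub ?_ ?_)
    · refine contDiffOn_cutoff.comp (contDiff_snd.div_const 2).contDiffOn fun q hq => ?_
      have := Set.mem_Ioi.1 hq.2
      exact Set.mem_Ioi.2 (by linarith)
    · exact contDiffOn_cutoff.comp contDiff_snd.contDiffOn hmem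
  have := VanishFam.of_contDiffOn hO (fun x hx => Set.mem_Ioi.2 (by linarith [Set.mem_Ici.1 hx]))
    hS (K := K) hsm (fun i _ s _ => ?_) fun s u hu => ?_
  · exact this
  · rw [hsm.partialSnd_iterate_eq_iteratedDeriv hU i ⟨Set.mem_univ s, by simp⟩]
    have : (fun u : ℝ => ((cutoff (u / 2) - cutoff u : ℝ) : ℂ)) =ᶠ[𝓝 0] fun _ => 0 := by
      filter_upwards [Ioo_mem_nhds (by norm_num : (-(1 / 2) : ℝ) < 0)
        (by norm_num : (0 : ℝ) < 1 / 2)] with x hx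
      rw [cutoff_eq_one (by linarith [hx.1]) (by linarith [hx.2]),
        cutoff_eq_one (by linarith [hx.1]) hx.2.le]
      simp
    rw [this.iteratedDeriv_eq]
    simp
  · simp only
    rw [cutoff_eq_zero (by linarith), cutoff_eq_zero (by linarith)]
    simp

/-- The Riemann sums of the functions `u^(-z) (cutoff(u/2) - cutoff(u))`, whose supports avoid
`0`, have no correction terms, for `z` in any bounded set. -/
theorem exists_dyadicSum_bound (B : ℝ) {J : ℕ} (hJ : 2 ≤ J) :
    ∃ C : ℝ, 0 ≤ C ∧ ∀ z : ℂ, ‖z‖ ≤ B → ∀ h : ℝ, 0 < h →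
      ‖∑' m : ℕ+, ((m * h : ℝ) : ℂ) ^ (-z) * ((cutoff (m * h / 2) - cutoff (m * h) : ℝ) : ℂ) -
        (h : ℂ)⁻¹ * ∫ u in Set.Ioi (0 : ℝ),
          (u : ℂ) ^ (-z) * ((cutoff (u / 2) - cutoff u : ℝ) : ℂ)‖ ≤ C * (h ^ J * h⁻¹) := by
  obtain ⟨K, hK⟩ := exists_nat_gt (J + 1 + |B|)
  have hb := abs_nonneg B
  have hKJ : J + 1 ≤ K := by
    have : ((J + 1 : ℕ) : ℝ) ≤ K := by push_cast; linarith
    exact_mod_cast this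
  have h1 := ((vanishFam_cutoff_sub (isCompact_closedBall (0 : ℂ) B) K).cpow_mul (B := B) (σ := B)
    (fun s hs => by simpa using hs)
    (fun s hs => (Complex.re_le_norm s).trans (by simpa using hs))).of_le hKJ
  obtain ⟨C, hC0, hC⟩ := h1.exists_riemannSum_bound (by linarith [le_abs_self B]) hJ
  exact ⟨C, hC0, fun z hz h hh => hC z (by simpa using hz) h hh⟩

/-- Halving the mesh of the truncated series adds a Riemann sum over a dyadic range. -/
theorem zetaCut_half_sub {h : ℝ} (hh : 0 < h) (z : ℂ) :
    zetaCut (h / 2) z - zetaCut h z = (h : ℂ) ^ z *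
      ∑' m : ℕ+, ((m * h : ℝ) : ℂ) ^ (-z) * ((cutoff (m * h / 2) - cutoff (m * h) : ℝ) : ℂ) := by
  rw [zetaCut, zetaCut, ← (summable_mul_cutoff (half_pos hh) _).tsum_sub
    (summable_mul_cutoff hh _), ← tsum_mul_left]
  refine tsum_congr fun m => ?_
  have hh' : (h : ℂ) ≠ 0 := by exact_mod_cast hh.ne'
  rw [Complex.ofReal_mul, Complex.mul_cpow_ofReal_nonneg (by positivity) hh.le,
    Complex.cpow_neg (h : ℂ)]
  have hz : (h : ℂ) ^ z ≠ 0 := by simp [Complex.cpow_eq_zero_iff, hh']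
  rw [mul_div_assoc]
  push_cast
  field_simp

/-- The truncated series of the alternating zeta function: in this combination of two truncations,
the main terms, proportional to `h^(z-1)`, cancel. -/
noncomputable def etaCut (h : ℝ) (z : ℂ) : ℂ :=
  zetaCut h z - 2 ^ (1 - z) * zetaCut (2 * h) z

theorem two_cpow_mul_cpow {h : ℝ} (hh : 0 < h) (z : ℂ) :
    (2 : ℂ) ^ (1 - z) * ((2 * h : ℝ) : ℂ) ^ z = 2 * (h : ℂ) ^ z := by
  rw [Complex.ofReal_mul, Complex.mul_cpow_ofReal_nonneg (by norm_num) hh.le, ← mul_assoc,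
    Complex.ofReal_ofNat, ← Complex.cpow_add _ _ two_ne_zero]
  simp

theorem norm_cpow_le_rpow_neg {h B : ℝ} (hh : 0 < h) (h1 : h ≤ 1) {z : ℂ} (hz : ‖z‖ ≤ B) :
    ‖(h : ℂ) ^ z‖ ≤ h ^ (-B) := by
  rw [Complex.norm_cpow_eq_rpow_re_of_pos hh]
  refine Real.rpow_le_rpow_of_exponent_ge hh h1 ?_
  exact (neg_le_neg hz).trans (neg_le_of_abs_le (Complex.abs_re_le_norm z))

/-- Halving the mesh changes the alternating truncated series by `O(h^N)`, for every `N`. -/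
theorem exists_etaCut_half_sub_bound (B : ℝ) (N : ℕ) :
    ∃ C : ℝ, 0 ≤ C ∧ ∀ z : ℂ, ‖z‖ ≤ B → ∀ h : ℝ, 0 < h → h ≤ 1 →
      ‖etaCut h z - etaCut (h / 2) z‖ ≤ C * h ^ N := by
  obtain ⟨k, hk⟩ := exists_nat_ge B
  -- The factor `h^z` costs at most `k` powers of `h`.
  obtain ⟨C, hC0, hC⟩ := exists_dyadicSum_bound B (J := N + k + 2) (by omega)
  refine ⟨C * (1 + 2 ^ (N + k + 2)), by positivity, fun z hz h hh h1 => ?_⟩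
  have e1 := hC z hz h hh
  have e2 := hC z hz (2 * h) (by positivity)
  have d1 := zetaCut_half_sub hh z
  have d2 := zetaCut_half_sub (show 0 < 2 * h by positivity) z
  rw [mul_div_cancel_left₀ h two_ne_zero] at d2
  set S1 := ∑' m : ℕ+, ((m * h : ℝ) : ℂ) ^ (-z) * ((cutoff (m * h / 2) - cutoff (m * h) : ℝ) : ℂ)
  set S2 := ∑' m : ℕ+, ((m * (2 * h) : ℝ) : ℂ) ^ (-z) *
    ((cutoff (m * (2 * h) / 2) - cutoff (m * (2 * h)) : ℝ) : ℂ)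
  set I := ∫ u in Set.Ioi (0 : ℝ), (u : ℂ) ^ (-z) * ((cutoff (u / 2) - cutoff u : ℝ) : ℂ)
  have hh' : (h : ℂ) ≠ 0 := by exact_mod_cast hh.ne'
  have key : etaCut h z - etaCut (h / 2) z =
      (h : ℂ) ^ z * (2 * (S2 - ((2 * h : ℝ) : ℂ)⁻¹ * I) - (S1 - (h : ℂ)⁻¹ * I)) := by
    have : etaCut h z - etaCut (h / 2) z = 2 ^ (1 - z) * (zetaCut h z - zetaCut (2 * h) z) -
        (zetaCut (h / 2) z - zetaCut h z) := by
      rw [etaCut, etaCut, mul_div_cancel₀ h two_ne_zero]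
      ring
    rw [this, d1, d2, ← mul_assoc, two_cpow_mul_cpow hh]
    push_cast
    field_simp
    ring
  rw [key, norm_mul]
  have hb : ‖2 * (S2 - ((2 * h : ℝ) : ℂ)⁻¹ * I) - (S1 - (h : ℂ)⁻¹ * I)‖ ≤
      C * (1 + 2 ^ (N + k + 2)) * h ^ (N + k + 1) := by
    refine (norm_sub_le _ _).trans ?_
    rw [norm_mul, Complex.norm_ofNat]
    refine (add_le_add (mul_le_mul_of_nonneg_left e2 (by norm_num)) e1).trans_eq ?_
    rw [mul_pow]
    field_simp
    ring
  calc ‖(h : ℂ) ^ z‖ * _ ≤ h ^ (-(k : ℝ)) * (C * (1 + 2 ^ (N + k + 2)) * h ^ (N + k + 1)) :=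
        mul_le_mul (norm_cpow_le_rpow_neg hh h1 (hz.trans hk)) hb (norm_nonneg _) (by positivity)
    _ = C * (1 + 2 ^ (N + k + 2)) * h ^ (N + 1) := by
        rw [Real.rpow_neg hh.le, Real.rpow_natCast]
        field_simp
        ring
    _ ≤ _ := by
        refine mul_le_mul_of_nonneg_left ?_ (by positivity)
        exact pow_le_pow_of_le_one hh.le h1 (Nat.le_succ N)

theorem norm_etaCut_sub_le_of_tendsto {z l : ℂ} {C : ℝ} {N : ℕ}
    (hC : ∀ h : ℝ, 0 < h → h ≤ 1 → ‖etaCut h z - etaCut (h / 2) z‖ ≤ C * h ^ (N + 1))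
    {h : ℝ} (hh : 0 < h) (h1 : h ≤ 1)
    (hl : Tendsto (fun i : ℕ => etaCut (h / 2 ^ i) z) atTop (𝓝 l)) :
    ‖etaCut h z - l‖ ≤ 2 * C * h ^ (N + 1) := by
  have hC0 : 0 ≤ C := by simpa using (norm_nonneg _).trans (hC 1 one_pos le_rfl)
  have := dist_le_of_le_geometric_two_of_tendsto₀ (C := 2 * C * h ^ (N + 1))
    (f := fun i : ℕ => etaCut (h / 2 ^ i) z) (a := l) (fun i => ?_) hl
  · simpa [dist_eq_norm] using this
  · have h2 : (1 : ℝ) ≤ 2 ^ i := one_le_pow₀ (by norm_num)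
    have hi : h / 2 ^ i ≤ 1 := (div_le_self hh.le h2).trans h1
    have := hC (h / 2 ^ i) (by positivity) hi
    rw [div_div, ← pow_succ] at this
    rw [dist_eq_norm]
    refine this.trans ?_
    rw [div_pow, pow_succ (2 ^ i)]
    have h3 : (1 : ℝ) ≤ (2 ^ i) ^ N := one_le_pow₀ h2
    calc C * (h ^ (N + 1) / ((2 ^ i) ^ N * 2 ^ i)) ≤ C * (h ^ (N + 1) / (1 * 2 ^ i)) := by gcongr
      _ = _ := by rw [one_mul]; ring

/-- Along dyadic `h → 0` the alternating truncated series converges, locally uniformly in `z`, to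
an entire function; this function is `(1 - 2^(1-z)) ζ(z)` for `Re z > 1`, hence everywhere. -/
theorem tendsto_etaCut_dyadic {h : ℝ} (hh : 0 < h) (h1 : h ≤ 1) {z : ℂ} (hz : z ≠ 1) :
    Tendsto (fun i : ℕ => etaCut (h / 2 ^ i) z) atTop (𝓝 ((1 - 2 ^ (1 - z)) * riemannZeta z)) := by
  have hpos : ∀ i : ℕ, 0 < h / 2 ^ i := fun i => by positivity
  have hle : ∀ i : ℕ, h / 2 ^ i ≤ 1 := fun i =>
    (div_le_self hh.le (one_le_pow₀ (by norm_num))).trans h1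
  have hlim : ∀ z : ℂ, ∃ l, Tendsto (fun i : ℕ => etaCut (h / 2 ^ i) z) atTop (𝓝 l) := by
    intro z
    obtain ⟨C, hC0, hC⟩ := exists_etaCut_half_sub_bound ‖z‖ 1
    refine cauchySeq_tendsto_of_complete
      (cauchySeq_of_le_geometric_two (C := 2 * C * h) fun i => ?_)
    have := hC z le_rfl (h / 2 ^ i) (hpos i) (hle i)
    rw [div_div, ← pow_succ] at this
    rw [dist_eq_norm]
    refine this.trans_eq ?_
    ring
  choose L hL using hlim
  have hz0 : Tendsto (fun i : ℕ => h / 2 ^ i) atTop (𝓝 0) := by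
    have := (tendsto_pow_atTop_nhds_zero_of_lt_one (r := (1 / 2 : ℝ)) (by norm_num)
      (by norm_num)).const_mul h
    simpa [div_eq_mul_inv] using this
  have hdiff : Differentiable ℂ L := by
    intro z
    obtain ⟨C, hC0, hC⟩ := exists_etaCut_half_sub_bound (‖z‖ + 1) 1
    have hunif : TendstoUniformlyOn (fun (i : ℕ) z => etaCut (h / 2 ^ i) z) L atTop
        (Metric.ball 0 (‖z‖ + 1)) := by
      rw [Metric.tendstoUniformlyOn_iff]
      intro ε hε
      have h2 : Tendsto (fun i : ℕ => 2 * C * (h / 2 ^ i) ^ (0 + 1)) atTop (𝓝 0) := by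
        simpa using hz0.const_mul (2 * C)
      filter_upwards [h2.eventually_lt_const hε] with i hi w hw
      rw [dist_comm, dist_eq_norm]
      refine lt_of_le_of_lt (norm_etaCut_sub_le_of_tendsto (hC w ?_) (hpos i) (hle i) ?_) hi
      · simpa using (le_of_lt (mem_ball_zero_iff.1 hw))
      · have := (tendsto_add_atTop_iff_nat i).2 (hL w)
        refine this.congr fun j => ?_
        rw [div_div, ← pow_add, add_comm]
    have := hunif.tendstoLocallyUniformlyOn.differentiableOn (Eventually.of_forall fun i =>
      ((differentiable_zetaCut (hpos i)).sub (Differentiable.mul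
        ((differentiable_id.const_sub 1).const_cpow (Or.inl two_ne_zero))
        (differentiable_zetaCut (by have := hpos i; positivity)))).differentiableOn)
      Metric.isOpen_ball
    exact this.differentiableAt (Metric.isOpen_ball.mem_nhds (by simp))
  have hid : Set.EqOn L (fun z => (1 - 2 ^ (1 - z)) * riemannZeta z) {1}ᶜ := by
    have hopen : IsOpen ({1}ᶜ : Set ℂ) := isOpen_compl_singleton
    have hA1 : AnalyticOnNhd ℂ L {1}ᶜ := hdiff.differentiableOn.analyticOnNhd hopen
    have hA2 : AnalyticOnNhd ℂ (fun z => (1 - 2 ^ (1 - z)) * riemannZeta z) {1}ᶜ := by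
      refine DifferentiableOn.analyticOnNhd (fun z hz => ?_) hopen
      refine DifferentiableAt.differentiableWithinAt (DifferentiableAt.mul ?_
        (differentiableAt_riemannZeta hz))
      exact ((differentiableAt_id.const_sub 1).const_cpow (Or.inl two_ne_zero)).const_sub 1
    refine hA1.eqOn_of_preconnected_of_eventuallyEq hA2
      (isConnected_compl_singleton_of_one_lt_rank (by simp) 1).isPreconnected
      (z₀ := 2) (by simp) ?_
    have hre : {z : ℂ | 1 < z.re} ∈ 𝓝 (2 : ℂ) :=
      (isOpen_lt continuous_const Complex.continuous_re).mem_nhds (by simp)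
    filter_upwards [hre] with z (hz : 1 < z.re)
    refine tendsto_nhds_unique (hL z) ?_
    have t1 : Tendsto (fun i : ℕ => h / 2 ^ i) atTop (𝓝[>] 0) :=
      tendsto_nhdsWithin_iff.2 ⟨hz0, Eventually.of_forall hpos⟩
    have t2 : Tendsto (fun i : ℕ => 2 * (h / 2 ^ i)) atTop (𝓝[>] 0) :=
      tendsto_nhdsWithin_iff.2 ⟨by simpa using hz0.const_mul 2,
        Eventually.of_forall fun i => Set.mem_Ioi.2 (by have := hpos i; positivity)⟩
    have := ((tendsto_zetaCut hz).comp t1).sub (((tendsto_zetaCut hz).comp t2).const_mul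
      ((2 : ℂ) ^ (1 - z)))
    rw [sub_mul, one_mul]
    exact this
  have := hL z
  rwa [hid hz] at this

theorem exists_etaCut_bound (B : ℝ) (N : ℕ) :
    ∃ C : ℝ, 0 ≤ C ∧ ∀ z : ℂ, ‖z‖ ≤ B → z ≠ 1 → ∀ h : ℝ, 0 < h → h ≤ 1 →
      ‖etaCut h z - (1 - 2 ^ (1 - z)) * riemannZeta z‖ ≤ C * h ^ N := by
  obtain ⟨C, hC0, hC⟩ := exists_etaCut_half_sub_bound B (N + 1)
  refine ⟨2 * C, by positivity, fun z hz hz1 h hh h1 => ?_⟩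
  refine (norm_etaCut_sub_le_of_tendsto (hC z hz) hh h1 (tendsto_etaCut_dyadic hh h1 hz1)).trans ?_
  exact mul_le_mul_of_nonneg_left (pow_le_pow_of_le_one hh.le h1 (Nat.le_succ N)) (by positivity)

open MeasureTheory in
theorem integrableOn_cpow_mul_cutoff {z : ℂ} (hz : z.re < 1) {ψ : ℝ → ℂ}
    (hcont : ContinuousOn ψ (Set.Ici 0)) :
    IntegrableOn (fun u : ℝ => (u : ℂ) ^ (-z) * ((cutoff u : ℂ) * ψ u)) (Set.Ioi 0) := by
  have h1 : IntegrableOn (fun u : ℝ => (u : ℂ) ^ (-z)) (Set.Icc 0 2) := by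
    rw [integrableOn_Icc_iff_integrableOn_Ioc,
      ← intervalIntegrable_iff_integrableOn_Ioc_of_le (by norm_num)]
    exact intervalIntegral.intervalIntegrable_cpow' (by simpa using hz)
  have h2 : ContinuousOn (fun u : ℝ => (cutoff u : ℂ) * ψ u) (Set.Icc 0 2) := by
    refine ContinuousOn.mul ?_ (hcont.mono Set.Icc_subset_Ici_self)
    refine Complex.continuous_ofReal.comp_continuousOn (contDiffOn_cutoff.continuousOn.mono ?_)
    intro x hx
    exact Set.mem_Ioi.2 (by linarith [hx.1])
  refine (h1.mul_continuousOn h2 isCompact_Icc).of_forall_sdiff_eq_zero measurableSet_Ioi ?_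
  intro u hu
  have hu0 : 0 < u := hu.1
  have : 2 ≤ u := by
    by_contra h
    exact hu.2 ⟨hu0.le, (not_le.1 h).le⟩
  rw [cutoff_eq_zero this]
  simp

open MeasureTheory in
/-- By the substitution `u = 2 v`, the Mellin integral of `cutoff(u/2)` is `2^(1-z)` times that of
`cutoff(u)`. -/
theorem integral_cpow_mul_cutoff_sub {z : ℂ} (hz : z.re < 1) :
    ∫ u in Set.Ioi (0 : ℝ), (u : ℂ) ^ (-z) * ((cutoff (u / 2) - cutoff u : ℝ) : ℂ) =
      (2 ^ (1 - z) - 1) * ∫ u in Set.Ioi (0 : ℝ), (u : ℂ) ^ (-z) * (cutoff u : ℂ) := by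
  have hi : IntegrableOn (fun u : ℝ => (u : ℂ) ^ (-z) * (cutoff u : ℂ)) (Set.Ioi 0) := by
    simpa using integrableOn_cpow_mul_cutoff hz (ψ := fun _ => 1) continuousOn_const
  have hscale : ∀ u ∈ Set.Ioi (0 : ℝ), ((2 * u : ℝ) : ℂ) ^ (-z) * (cutoff (2 * u / 2) : ℂ) =
      (2 : ℂ) ^ (-z) * ((u : ℂ) ^ (-z) * (cutoff u : ℂ)) := by
    intro u hu
    rw [mul_div_cancel_left₀ u two_ne_zero, Complex.ofReal_mul,
      Complex.mul_cpow_ofReal_nonneg (by norm_num) (le_of_lt hu)]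
    push_cast
    ring
  have hi2 : IntegrableOn (fun u : ℝ => (u : ℂ) ^ (-z) * (cutoff (u / 2) : ℂ)) (Set.Ioi 0) := by
    have := (integrableOn_Ioi_comp_mul_left_iff
      (fun u : ℝ => (u : ℂ) ^ (-z) * (cutoff (u / 2) : ℂ)) 0 two_pos).1
      ((integrableOn_congr_fun hscale measurableSet_Ioi).2 (hi.const_mul _))
    simpa using this
  have h2 := integral_comp_mul_left_Ioi
    (fun u : ℝ => (u : ℂ) ^ (-z) * (cutoff (u / 2) : ℂ)) 0 (two_pos (α := ℝ))
  rw [setIntegral_congr_fun measurableSet_Ioi hscale, integral_const_mul, mul_zero] at h2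
  have h3 : ∫ u in Set.Ioi (0 : ℝ), (u : ℂ) ^ (-z) * (cutoff (u / 2) : ℂ) =
      2 ^ (1 - z) * ∫ u in Set.Ioi (0 : ℝ), (u : ℂ) ^ (-z) * (cutoff u : ℂ) := by
    rw [sub_eq_add_neg, Complex.cpow_add _ _ two_ne_zero, Complex.cpow_one, mul_assoc, h2,
      Complex.real_smul]
    push_cast
    ring
  simp only [Complex.ofReal_sub, mul_sub]
  rw [integral_sub hi2 hi, h3]
  ring

open MeasureTheory in
/-- The Euler–Maclaurin expansion of the smoothly truncated zeta series: besides the main term and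
`ζ(z)` there is no other term, because the cutoff is constant near `0`. -/
theorem exists_zetaCut_bound (B : ℝ) {σ : ℝ} (hσ : σ < 1) (N : ℕ) :
    ∃ C : ℝ, 0 ≤ C ∧ ∀ z : ℂ, ‖z‖ ≤ B → z.re ≤ σ → ∀ h : ℝ, 0 < h → h ≤ 1 →
      ‖zetaCut h z - (h : ℂ) ^ z * (h : ℂ)⁻¹ *
          (∫ u in Set.Ioi (0 : ℝ), (u : ℂ) ^ (-z) * (cutoff u : ℂ)) - riemannZeta z‖
        ≤ C * h ^ N := by
  obtain ⟨k, hk⟩ := exists_nat_ge B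
  obtain ⟨C, hC0, hC⟩ := exists_dyadicSum_bound B (J := N + k + 2) (by omega)
  obtain ⟨D, hD0, hD⟩ := exists_etaCut_bound B N
  have hδ : 0 < (2 : ℝ) ^ (1 - σ) - 1 := by
    have := Real.one_lt_rpow (x := 2) (by norm_num) (by linarith : 0 < 1 - σ)
    linarith
  set δ := (2 : ℝ) ^ (1 - σ) - 1 with hδdef
  refine ⟨(D + 2 * (C * 2 ^ (N + k + 2))) / δ, by positivity, fun z hz hzσ h hh h1 => ?_⟩
  have hre : z.re < 1 := hzσ.trans_lt hσ
  have hz1 : z ≠ 1 := by rintro rfl; simp at hre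
  have e1 := hC z hz (2 * h) (by positivity)
  have e2 := hD z hz hz1 h hh h1
  have d2 := zetaCut_half_sub (show 0 < 2 * h by positivity) z
  rw [mul_div_cancel_left₀ h two_ne_zero] at d2
  rw [integral_cpow_mul_cutoff_sub hre] at e1
  have h2z := two_cpow_mul_cpow hh z
  have heta : etaCut h z = zetaCut h z - 2 ^ (1 - z) * zetaCut (2 * h) z := rfl
  have hc : δ ≤ ‖1 - (2 : ℂ) ^ (1 - z)‖ := by
    have h3 : ‖(2 : ℂ) ^ (1 - z)‖ = 2 ^ (1 - z.re) := by
      have := Complex.norm_cpow_eq_rpow_re_of_pos (x := 2) two_pos (1 - z)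
      simpa using this
    have h4 := norm_sub_norm_le ((2 : ℂ) ^ (1 - z)) 1
    rw [norm_one, h3, norm_sub_rev] at h4
    refine le_trans ?_ h4
    have : (2 : ℝ) ^ (1 - σ) ≤ 2 ^ (1 - z.re) :=
      Real.rpow_le_rpow_of_exponent_le (by norm_num) (by linarith)
    linarith
  set S2 := ∑' m : ℕ+, ((m * (2 * h) : ℝ) : ℂ) ^ (-z) *
    ((cutoff (m * (2 * h) / 2) - cutoff (m * (2 * h)) : ℝ) : ℂ)
  set I := ∫ u in Set.Ioi (0 : ℝ), (u : ℂ) ^ (-z) * (cutoff u : ℂ)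
  set c := (2 : ℂ) ^ (1 - z)
  have hh' : (h : ℂ) ≠ 0 := by exact_mod_cast hh.ne'
  have key : (1 - c) * (zetaCut h z - (h : ℂ) ^ z * (h : ℂ)⁻¹ * I - riemannZeta z) =
      (etaCut h z - (1 - c) * riemannZeta z) -
        2 * ((h : ℂ) ^ z * (S2 - ((2 * h : ℝ) : ℂ)⁻¹ * ((c - 1) * I))) := by
    have : (1 - c) * zetaCut h z = etaCut h z - c * (((2 * h : ℝ) : ℂ) ^ z * S2) := by
      rw [heta, ← d2]; ring
    rw [mul_sub, mul_sub, this, ← mul_assoc c, h2z]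
    push_cast
    field_simp
    ring
  have hb : ‖(h : ℂ) ^ z * (S2 - ((2 * h : ℝ) : ℂ)⁻¹ * ((c - 1) * I))‖
      ≤ C * 2 ^ (N + k + 2) * h ^ N := by
    rw [norm_mul]
    calc _ ≤ h ^ (-(k : ℝ)) * (C * ((2 * h) ^ (N + k + 2) * (2 * h)⁻¹)) :=
          mul_le_mul (norm_cpow_le_rpow_neg hh h1 (hz.trans hk)) e1 (norm_nonneg _) (by positivity)
      _ = C * 2 ^ (N + k + 1) * h ^ (N + 1) := by
          rw [Real.rpow_neg hh.le, Real.rpow_natCast, mul_pow]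
          field_simp
          ring
      _ ≤ _ := by
          have := pow_le_pow_of_le_one hh.le h1 (Nat.le_succ N)
          gcongr
          · norm_num
          · omega
  have hfin := norm_sub_le (etaCut h z - (1 - c) * riemannZeta z)
    (2 * ((h : ℂ) ^ z * (S2 - ((2 * h : ℝ) : ℂ)⁻¹ * ((c - 1) * I))))
  rw [← key, norm_mul, norm_mul, Complex.norm_ofNat] at hfin
  rw [div_mul_eq_mul_div, le_div_iff₀ hδ, mul_comm]
  refine (mul_le_mul_of_nonneg_right hc (norm_nonneg _)).trans (hfin.trans ?_)
  linarith

/-! ### Complex powers of a positive polynomial -/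

section PolyCpow

variable {p : Polynomial ℝ}

theorem aeval_ofReal_eq (p : Polynomial ℝ) (u : ℝ) :
    Polynomial.aeval (u : ℂ) p = ((p.eval u : ℝ) : ℂ) :=
  Polynomial.aeval_algebraMap_apply_eq_algebraMap_eval u p

theorem polyCpow_ofReal (p : Polynomial ℝ) (a : ℂ) (u : ℝ) :
    polyCpow p a u = ((p.eval u : ℝ) : ℂ) ^ a := by
  rw [polyCpow, aeval_ofReal_eq]

/-- The open set where the principal branch of the powers of `p` is holomorphic. -/
def cpowDomain (p : Polynomial ℝ) : Set ℂ := {x | Polynomial.aeval x p ∈ Complex.slitPlane}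

theorem mem_cpowDomain_ofReal {u : ℝ} (hu : 0 < p.eval u) : (u : ℂ) ∈ cpowDomain p := by
  change Polynomial.aeval (u : ℂ) p ∈ Complex.slitPlane
  rw [aeval_ofReal_eq]
  exact Complex.ofReal_mem_slitPlane.2 hu

theorem isOpen_cpowDomain (p : Polynomial ℝ) : IsOpen (cpowDomain p) :=
  Complex.isOpen_slitPlane.preimage p.continuous_aeval

theorem contDiffOn_polyCpow (p : Polynomial ℝ) :
    ContDiffOn ℂ (⊤ : ℕ∞) (fun q : ℂ × ℂ => polyCpow p (-q.1) q.2)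
      (Set.univ ×ˢ cpowDomain p) := by
  intro q hq
  refine ContDiffAt.contDiffWithinAt (AnalyticAt.contDiffAt ?_)
  have h1 : AnalyticAt ℂ (fun q : ℂ × ℂ => Polynomial.aeval q.2 p) q :=
    AnalyticAt.aeval_polynomial analyticAt_snd p
  exact h1.cpow analyticAt_fst.neg hq.2

theorem contDiffOn_polyCpow_right (p : Polynomial ℝ) (s : ℂ) :
    ContDiffOn ℂ (⊤ : ℕ∞) (polyCpow p (-s)) (cpowDomain p) :=
  (contDiffOn_polyCpow p).comp (f := fun x : ℂ => (s, x)) (by fun_prop)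
    fun _ hx => ⟨Set.mem_univ _, hx⟩

/-- The Taylor coefficients of `p^(-s)` are mixed partial derivatives of a function holomorphic in
both variables, so they are entire in `s`. -/
theorem differentiable_taylorCoeffZero_polyCpow (hp : 0 < p.eval 0) (k : ℕ) :
    Differentiable ℂ fun s => taylorCoeffZero (polyCpow p (-s)) k := by
  have hU : IsOpen ((Set.univ : Set ℂ) ×ˢ cpowDomain p) := isOpen_univ.prod (isOpen_cpowDomain p)
  have h0 : (0 : ℂ) ∈ cpowDomain p := by simpa using mem_cpowDomain_ofReal hp
  have hmem : ∀ s : ℂ, (s, (0 : ℂ)) ∈ (Set.univ : Set ℂ) ×ˢ cpowDomain p :=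
    fun s => ⟨Set.mem_univ s, h0⟩
  have h1 : (fun s => taylorCoeffZero (polyCpow p (-s)) k) = fun s =>
      (partialSnd ℂ)^[k] (fun q : ℂ × ℂ => polyCpow p (-q.1) q.2) (s, 0) / (k ! : ℂ) := by
    funext s
    rw [(contDiffOn_polyCpow p).partialSnd_iterate_eq_iteratedDeriv hU k (hmem s)]
    rfl
  rw [h1]
  intro s
  have h2 := (((contDiffOn_polyCpow p).partialSnd_iterate hU k).differentiableOn
    (by simp)).differentiableAt (hU.mem_nhds (hmem s))
  exact (h2.comp s (f := fun s : ℂ => (s, (0 : ℂ))) (by fun_prop)).div_const _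

/-- The derivatives of the restriction to the real line of a holomorphic function. -/
theorem iteratedDeriv_comp_ofReal {g : ℂ → ℂ} {V : Set ℂ} (hV : IsOpen V)
    (hg : ContDiffOn ℂ (⊤ : ℕ∞) g V) (k : ℕ) {u : ℝ} (hu : (u : ℂ) ∈ V) :
    iteratedDeriv k (fun u : ℝ => g u) u = iteratedDeriv k g u := by
  induction k generalizing u with
  | zero => simp
  | succ k ih =>
    rw [iteratedDeriv_succ, iteratedDeriv_succ]
    have h1 : iteratedDeriv k (fun u : ℝ => g u) =ᶠ[𝓝 u] fun u : ℝ => iteratedDeriv k g u := by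
      filter_upwards [Complex.continuous_ofReal.continuousAt.preimage_mem_nhds
        (hV.mem_nhds hu)] with x hx using ih hx
    rw [h1.deriv_eq]
    have h2 : DifferentiableAt ℂ (iteratedDeriv k g) u := by
      rw [iteratedDeriv_eq_iterate]
      exact (((hg.differentiableOn (by simp)).analyticOnNhd hV).iterated_deriv k _
        hu).differentiableAt
    exact h2.hasDerivAt.comp_ofReal.deriv

theorem iteratedDeriv_sub_taylor {g : ℂ → ℂ} (hg : ContDiffAt ℂ (⊤ : ℕ∞) g 0) {K i : ℕ}
    (hi : i < K) :
    iteratedDeriv i (fun x => g x - ∑ k ∈ Finset.range K, taylorCoeffZero g k * x ^ k) 0 = 0 := by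
  have h1 : ContDiffAt ℂ i (fun x : ℂ => ∑ k ∈ Finset.range K, taylorCoeffZero g k * x ^ k) 0 := by
    fun_prop
  rw [iteratedDeriv_fun_sub (hg.of_le (by exact_mod_cast le_top)) h1,
    iteratedDeriv_fun_sum fun k _ => by fun_prop]
  simp only [iteratedDeriv_const_mul_field]
  rw [Finset.sum_eq_single i]
  · rw [iteratedDeriv_fun_pow_zero, if_pos rfl, taylorCoeffZero,
      div_mul_cancel₀ _ (by exact_mod_cast i.factorial_ne_zero), sub_self]
  · intro k _ hk
    rw [iteratedDeriv_fun_pow_zero, if_neg hk.symm, Nat.cast_zero, mul_zero]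
  · intro h
    exact absurd (Finset.mem_range.2 hi) h

/-- The remainder, multiplied by the cutoff, of the Taylor expansion of `p(u)^(-s)` at `u = 0`. -/
noncomputable def taylorRem (p : Polynomial ℝ) (K : ℕ) (q : ℂ × ℝ) : ℂ :=
  (cutoff q.2 : ℂ) * (polyCpow p (-q.1) q.2 -
    ∑ k ∈ Finset.range K, taylorCoeffZero (polyCpow p (-q.1)) k * (q.2 : ℂ) ^ k)

/-- The family `taylorRem p K` vanishes at `0` to order `K`, since the cutoff is constant near
`0`. -/
theorem vanishFam_taylorRem (hp : ∀ x : ℝ, 0 ≤ x → 0 < p.eval x) {S : Set ℂ} (hS : IsCompact S)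
    (K : ℕ) : VanishFam S K K (fun s u => taylorRem p K (s, u)) := by
  set O : Set ℝ := Set.Ioi (-1) ∩ (fun u => p.eval u) ⁻¹' Set.Ioi 0 with hOdef
  have hO : IsOpen O := isOpen_Ioi.inter (isOpen_Ioi.preimage p.continuous)
  have hU : IsOpen ((Set.univ : Set ℂ) ×ˢ O) := isOpen_univ.prod hO
  have h0O : Set.Ici 0 ⊆ O := fun x hx =>
    ⟨Set.mem_Ioi.2 (by linarith [Set.mem_Ici.1 hx]), Set.mem_Ioi.2 (hp x hx)⟩
  have h0 : (0 : ℂ) ∈ cpowDomain p := by simpa using mem_cpowDomain_ofReal (hp 0 le_rfl)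
  have hsm : ContDiffOn ℝ (⊤ : ℕ∞) (taylorRem p K) (Set.univ ×ˢ O) := by
    refine ContDiffOn.mul ?_ (ContDiffOn.sub ?_ (ContDiffOn.sum fun k _ => ContDiffOn.mul ?_ ?_))
    · exact Complex.ofRealCLM.contDiff.comp_contDiffOn
        (contDiffOn_cutoff.comp contDiff_snd.contDiffOn fun q hq => hq.2.1)
    · refine ((contDiffOn_polyCpow p).restrict_scalars ℝ).comp
        (f := fun q : ℂ × ℝ => (q.1, (q.2 : ℂ))) ?_ fun q hq =>
          ⟨Set.mem_univ _, mem_cpowDomain_ofReal hq.2.2⟩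
      exact (contDiff_fst.prodMk (Complex.ofRealCLM.contDiff.comp contDiff_snd)).contDiffOn
    · have : ContDiff ℝ (⊤ : ℕ∞) fun s => taylorCoeffZero (polyCpow p (-s)) k :=
        (differentiable_taylorCoeffZero_polyCpow (hp 0 le_rfl) k).contDiff.restrict_scalars ℝ
      exact (this.comp contDiff_fst).contDiffOn
    · exact ((Complex.ofRealCLM.contDiff.comp contDiff_snd).pow k).contDiffOn
  refine VanishFam.of_contDiffOn hO h0O hS hsm (fun i hi s _ => ?_) fun s u hu => ?_
  · rw [hsm.partialSnd_iterate_eq_iteratedDeriv hU i ⟨Set.mem_univ s, h0O (by simp)⟩]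
    have h1 : (fun u : ℝ => taylorRem p K (s, u)) =ᶠ[𝓝 0] fun u : ℝ =>
        (fun x : ℂ => polyCpow p (-s) x - ∑ k ∈ Finset.range K,
          taylorCoeffZero (polyCpow p (-s)) k * x ^ k) u := by
      filter_upwards [Ioo_mem_nhds (by norm_num : (-1 : ℝ) < 0)
        (by norm_num : (0 : ℝ) < 1 / 2)] with x hx
      rw [taylorRem, cutoff_eq_one hx.1 hx.2.le]
      simp
    have h2 := iteratedDeriv_comp_ofReal (isOpen_cpowDomain p) (g := fun x => polyCpow p (-s) x -
      ∑ k ∈ Finset.range K, taylorCoeffZero (polyCpow p (-s)) k * x ^ k)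
      ((contDiffOn_polyCpow_right p s).sub (by fun_prop)) i (u := 0)
      (by rwa [Complex.ofReal_zero])
    rw [h1.iteratedDeriv_eq, h2, Complex.ofReal_zero]
    exact iteratedDeriv_sub_taylor ((contDiffOn_polyCpow_right p s).contDiffAt
      ((isOpen_cpowDomain p).mem_nhds h0)) hi
  · rw [taylorRem, cutoff_eq_zero (by simp only; linarith)]
    simp

theorem continuousOn_polyCpow_ofReal (hp : ∀ x : ℝ, 0 ≤ x → 0 < p.eval x) (s : ℂ) :
    ContinuousOn (fun u : ℝ => polyCpow p (-s) u) (Set.Ici 0) :=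
  (contDiffOn_polyCpow_right p s).continuousOn.comp Complex.continuous_ofReal.continuousOn
    fun u hu => mem_cpowDomain_ofReal (hp u hu)

end PolyCpow

/-! ### Riemann sums of `u^(-s) p(u)^(-s)` near `u = 0` -/

/-- The Riemann sum (without the factor `h`) of `u^(-s) cutoff(u) p(u)^(-s)` with mesh `h`. -/
noncomputable def cutSum (p : Polynomial ℝ) (h : ℝ) (s : ℂ) : ℂ :=
  ∑' m : ℕ+, ((m * h : ℝ) : ℂ) ^ (-s) * polyCpow p (-s) (m * h : ℝ) * (cutoff (m * h) : ℂ)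

/-- The integral of `u^(-s) cutoff(u) p(u)^(-s)` over the positive half-line. -/
noncomputable def cutIntegral (p : Polynomial ℝ) (s : ℂ) : ℂ :=
  ∫ u in Set.Ioi (0 : ℝ), (u : ℂ) ^ (-s) * ((cutoff u : ℂ) * polyCpow p (-s) u)

/-- The error term of the Euler–Maclaurin expansion of `cutSum` with `K` correction terms, which
come from the singularity of the summand at `u = 0`. -/
noncomputable def cutErr (p : Polynomial ℝ) (K : ℕ) (h : ℝ) (s : ℂ) : ℂ :=
  cutSum p h s - (h : ℂ)⁻¹ * cutIntegral p s -
    ∑ k ∈ Finset.range K, taylorCoeffZero (polyCpow p (-s)) k * riemannZeta (s - k) *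
      (h : ℂ) ^ (-(s - k))

section CutErr

variable {p : Polynomial ℝ}

theorem cpow_neg_sub_natCast {x : ℝ} (hx : 0 < x) (s : ℂ) (k : ℕ) :
    (x : ℂ) ^ (-(s - k)) = (x : ℂ) ^ (-s) * (x : ℂ) ^ k := by
  rw [neg_sub, sub_eq_neg_add, Complex.cpow_add _ _ (by exact_mod_cast hx.ne'),
    Complex.cpow_natCast]

/-- Splitting the summand of `cutSum` into its Taylor polynomial at `0` and the remainder. -/
theorem cutSum_eq (p : Polynomial ℝ) (K : ℕ) {h : ℝ} (hh : 0 < h) (s : ℂ) :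
    cutSum p h s = (∑ k ∈ Finset.range K, taylorCoeffZero (polyCpow p (-s)) k *
        ((h : ℂ) ^ (-(s - k)) * zetaCut h (s - k))) +
      ∑' m : ℕ+, ((m * h : ℝ) : ℂ) ^ (-s) * taylorRem p K (s, m * h) := by
  have h1 : ∀ k ∈ Finset.range K, taylorCoeffZero (polyCpow p (-s)) k *
        ((h : ℂ) ^ (-(s - k)) * zetaCut h (s - k)) = ∑' m : ℕ+,
      (taylorCoeffZero (polyCpow p (-s)) k * (((m * h : ℝ) : ℂ) ^ (-s) * ((m * h : ℝ) : ℂ) ^ k)) *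
        (cutoff (m * h) : ℂ) := by
    intro k _
    rw [zetaCut, ← tsum_mul_left, ← tsum_mul_left]
    refine tsum_congr fun m => ?_
    have hm : (0 : ℝ) < m := by exact_mod_cast m.pos
    rw [← cpow_neg_sub_natCast (by positivity), Complex.ofReal_mul,
      Complex.mul_cpow_ofReal_nonneg hm.le hh.le]
    push_cast
    ring
  rw [Finset.sum_congr rfl h1, ← Summable.tsum_finsetSum fun k _ => summable_mul_cutoff hh _,
    ← Summable.tsum_add]
  · refine tsum_congr fun m => ?_
    rw [taylorRem, ← Finset.sum_mul]
    simp only [mul_left_comm _ (((m * h : ℝ) : ℂ) ^ (-s))]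
    rw [← Finset.mul_sum]
    ring
  · exact summable_sum fun k _ => summable_mul_cutoff hh _
  · refine (summable_mul_cutoff hh fun m => ((m * h : ℝ) : ℂ) ^ (-s) *
      (polyCpow p (-s) (m * h : ℝ) - ∑ k ∈ Finset.range K,
        taylorCoeffZero (polyCpow p (-s)) k * ((m * h : ℝ) : ℂ) ^ k)).congr fun m => ?_
    rw [taylorRem]
    ring

open MeasureTheory in
theorem cutIntegral_eq (hp : ∀ x : ℝ, 0 ≤ x → 0 < p.eval x) (K : ℕ) {s : ℂ} (hs : s.re < 1) :
    cutIntegral p s = (∑ k ∈ Finset.range K, taylorCoeffZero (polyCpow p (-s)) k *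
        ∫ u in Set.Ioi (0 : ℝ), (u : ℂ) ^ (-(s - k)) * (cutoff u : ℂ)) +
      ∫ u in Set.Ioi (0 : ℝ), (u : ℂ) ^ (-s) * taylorRem p K (s, u) := by
  have hpow : ∀ k : ℕ, IntegrableOn (fun u : ℝ => (u : ℂ) ^ (-s) *
      ((cutoff u : ℂ) * (taylorCoeffZero (polyCpow p (-s)) k * (u : ℂ) ^ k))) (Set.Ioi 0) :=
    fun k => integrableOn_cpow_mul_cutoff hs (by fun_prop)
  have h1 : ∀ k ∈ Finset.range K, taylorCoeffZero (polyCpow p (-s)) k *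
        ∫ u in Set.Ioi (0 : ℝ), (u : ℂ) ^ (-(s - k)) * (cutoff u : ℂ) =
      ∫ u in Set.Ioi (0 : ℝ), (u : ℂ) ^ (-s) *
        ((cutoff u : ℂ) * (taylorCoeffZero (polyCpow p (-s)) k * (u : ℂ) ^ k)) := by
    intro k _
    rw [← integral_const_mul]
    refine setIntegral_congr_fun measurableSet_Ioi fun u hu => ?_
    rw [cpow_neg_sub_natCast hu]
    ring
  rw [Finset.sum_congr rfl h1, ← integral_finsetSum _ fun k _ => hpow k, ← integral_add]
  · refine integral_congr_ae (Eventually.of_forall fun u => ?_)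
    simp only [taylorRem]
    rw [← Finset.mul_sum, ← Finset.mul_sum]
    ring
  · exact integrable_finsetSum _ fun k _ => hpow k
  · refine integrableOn_cpow_mul_cutoff hs (ψ := fun u : ℝ => polyCpow p (-s) u -
      ∑ k ∈ Finset.range K, taylorCoeffZero (polyCpow p (-s)) k * (u : ℂ) ^ k) ?_
    exact (continuousOn_polyCpow_ofReal hp s).sub (by fun_prop)

theorem IsCompact.exists_re_le_of_re_lt_one {S : Set ℂ} (hS : IsCompact S)
    (hre : ∀ s ∈ S, s.re < 1) : ∃ σ : ℝ, σ < 1 ∧ ∀ s ∈ S, s.re ≤ σ := by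
  rcases S.eq_empty_or_nonempty with rfl | hne
  · exact ⟨0, by norm_num, by simp⟩
  · obtain ⟨s0, hs0, hmax⟩ := hS.exists_isMaxOn hne Complex.continuous_re.continuousOn
    exact ⟨s0.re, hre s0 hs0, fun s hs => hmax hs⟩

/-- The Euler–Maclaurin expansion of `cutSum`, uniform for `s` in a compact subset of `Re s < 1`.
The Taylor polynomial contributes truncated zeta series, and the Taylor remainder vanishes at `0`
to such an order that its Riemann sums have no correction terms. -/
theorem exists_cutErr_bound (hp : ∀ x : ℝ, 0 ≤ x → 0 < p.eval x) {S : Set ℂ} (hS : IsCompact S)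
    (hre : ∀ s ∈ S, s.re < 1) (K : ℕ) :
    ∃ C : ℝ, 0 ≤ C ∧ ∀ s ∈ S, ∀ h : ℝ, 0 < h → h ≤ 1 →
      ‖cutErr p (K + 4) h s‖ ≤ C * h ^ (K + 1) := by
  obtain ⟨σ, hσ, hσS⟩ := hS.exists_re_le_of_re_lt_one hre
  obtain ⟨B, hB⟩ := hS.isBounded.exists_norm_le
  have hB' : ∀ s ∈ S, ∀ k ∈ Finset.range (K + 4), ‖s - (k : ℂ)‖ ≤ B + (K + 4) := by
    intro s hs k hk
    have hk' : (k : ℝ) ≤ K + 4 := by exact_mod_cast (Finset.mem_range.1 hk).le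
    refine (norm_sub_le _ _).trans (add_le_add (hB s hs) ?_)
    simpa using hk'
  obtain ⟨b, hb⟩ := exists_nat_ge (B + (K + 4))
  -- The exponent `b` makes up for the factors `h^(-(s-k))`, which are `O(h^(-b))`.
  obtain ⟨C, hC0, hC⟩ := exists_zetaCut_bound (B + (K + 4)) hσ (b + (K + 1))
  have hcoef : ∀ k : ℕ, ∃ D : ℝ, 0 ≤ D ∧ ∀ s ∈ S, ‖taylorCoeffZero (polyCpow p (-s)) k‖ ≤ D := by
    intro k
    obtain ⟨D, hD⟩ := hS.exists_bound_of_continuousOn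
      (differentiable_taylorCoeffZero_polyCpow (hp 0 le_rfl) k).continuous.continuousOn
    exact ⟨|D|, abs_nonneg D, fun s hs => (hD s hs).trans (le_abs_self D)⟩
  choose D hD0 hD using hcoef
  -- The factor `u^(-s)` costs one of the `K + 4` orders of vanishing; the remaining `K + 3` give a
  -- function of class `C^(K+2)`, and the division by `h` costs one more power.
  obtain ⟨M, hM0, hM⟩ := (((vanishFam_taylorRem hp hS (K + 4)).cpow_mul hB
    fun s hs => (hre s hs).le).of_le (show K + 2 + 1 ≤ K + 4 by omega)).exists_riemannSum_bound
      (by push_cast; linarith) (by omega)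
  refine ⟨(∑ k ∈ Finset.range (K + 4), D k * C) + M, by
    have := Finset.sum_nonneg fun k (_ : k ∈ Finset.range (K + 4)) => mul_nonneg (hD0 k) hC0
    positivity, fun s hs h hh h1 => ?_⟩
  have hh' : (h : ℂ) ≠ 0 := by exact_mod_cast hh.ne'
  have hdecomp : cutErr p (K + 4) h s = (∑ k ∈ Finset.range (K + 4),
      taylorCoeffZero (polyCpow p (-s)) k * ((h : ℂ) ^ (-(s - k)) *
        (zetaCut h (s - k) - (h : ℂ) ^ (s - k) * (h : ℂ)⁻¹ *
          (∫ u in Set.Ioi (0 : ℝ), (u : ℂ) ^ (-(s - k)) * (cutoff u : ℂ)) - riemannZeta (s - k)))) +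
      (∑' m : ℕ+, ((m * h : ℝ) : ℂ) ^ (-s) * taylorRem p (K + 4) (s, m * h) -
        (h : ℂ)⁻¹ * ∫ u in Set.Ioi (0 : ℝ), (u : ℂ) ^ (-s) * taylorRem p (K + 4) (s, u)) := by
    rw [cutErr, cutSum_eq p (K + 4) hh s, cutIntegral_eq hp (K + 4) (hre s hs), mul_add,
      Finset.mul_sum]
    have hk : ∀ k ∈ Finset.range (K + 4), taylorCoeffZero (polyCpow p (-s)) k *
        ((h : ℂ) ^ (-(s - k)) * (zetaCut h (s - k) - (h : ℂ) ^ (s - k) * (h : ℂ)⁻¹ *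
          (∫ u in Set.Ioi (0 : ℝ), (u : ℂ) ^ (-(s - k)) * (cutoff u : ℂ)) -
            riemannZeta (s - k))) =
        taylorCoeffZero (polyCpow p (-s)) k * ((h : ℂ) ^ (-(s - k)) * zetaCut h (s - k)) -
        (h : ℂ)⁻¹ * (taylorCoeffZero (polyCpow p (-s)) k *
          ∫ u in Set.Ioi (0 : ℝ), (u : ℂ) ^ (-(s - k)) * (cutoff u : ℂ)) -
        taylorCoeffZero (polyCpow p (-s)) k * riemannZeta (s - k) * (h : ℂ) ^ (-(s - k)) := by
      intro k _
      have : (h : ℂ) ^ (-(s - k)) * (h : ℂ) ^ (s - k) = 1 := by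
        rw [← Complex.cpow_add _ _ hh', neg_add_cancel, Complex.cpow_zero]
      linear_combination (-(h : ℂ)⁻¹ * (taylorCoeffZero (polyCpow p (-s)) k *
          ∫ u in Set.Ioi (0 : ℝ), (u : ℂ) ^ (-(s - k)) * (cutoff u : ℂ))) * this
    rw [Finset.sum_congr rfl hk, Finset.sum_sub_distrib, Finset.sum_sub_distrib]
    ring
  rw [hdecomp, add_mul, Finset.sum_mul]
  refine (norm_add_le _ _).trans (add_le_add ((norm_sum_le _ _).trans
    (Finset.sum_le_sum fun k hk => ?_)) ?_)
  · rw [norm_mul, norm_mul, mul_assoc (D k)]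
    refine mul_le_mul (hD k s hs) ?_ (mul_nonneg (norm_nonneg _) (norm_nonneg _)) (hD0 k)
    have e1 := hC (s - k) (hB' s hs k hk)
      ((by simp : (s - k : ℂ).re ≤ s.re).trans (hσS s hs)) h hh h1
    have e2 := norm_cpow_le_rpow_neg hh h1 (z := -(s - k))
      (B := b) (by rw [norm_neg]; exact (hB' s hs k hk).trans hb)
    refine (mul_le_mul e2 e1 (norm_nonneg _) (by positivity)).trans_eq ?_
    rw [Real.rpow_neg hh.le, Real.rpow_natCast, pow_add]
    field_simp
  · refine (hM s hs h hh).trans_eq ?_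
    rw [pow_succ]
    field_simp

end CutErr

/-! ### Holomorphy of the Euler–Maclaurin expansion -/

theorem differentiableAt_riemannZeta_sub_natCast {s : ℂ} (hs : s.re < 1) (k : ℕ) :
    DifferentiableAt ℂ (fun s => riemannZeta (s - k)) s := by
  have h1 : s - k ≠ 1 := by
    intro h
    have := congrArg Complex.re h
    simp only [Complex.sub_re, Complex.natCast_re, Complex.one_re] at this
    linarith [(Nat.cast_nonneg k : (0 : ℝ) ≤ k)]
  exact (differentiableAt_riemannZeta h1).comp s (differentiableAt_id.sub_const _)

theorem isOpen_setOf_re_lt_one : IsOpen {s : ℂ | s.re < 1} :=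
  isOpen_lt Complex.continuous_re continuous_const

section Holomorphy

variable {p : Polynomial ℝ}

theorem differentiable_cutSum (hp : ∀ x : ℝ, 0 ≤ x → 0 < p.eval x) {h : ℝ} (hh : 0 < h) :
    Differentiable ℂ (cutSum p h) := by
  have : cutSum p h = fun s => ∑ m ∈ (finite_setOf_pnat_mul_lt hh).toFinset,
      ((m * h : ℝ) : ℂ) ^ (-s) * polyCpow p (-s) (m * h : ℝ) * (cutoff (m * h) : ℂ) :=
    funext fun s => tsum_mul_cutoff_eq_sum hh _
  rw [this]
  refine Differentiable.fun_sum fun m _ => ?_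
  have hm : (0 : ℝ) < m * h := mul_pos (by exact_mod_cast m.pos) hh
  have h1 : ((m * h : ℝ) : ℂ) ≠ 0 := by exact_mod_cast hm.ne'
  have h2 : ((p.eval (m * h : ℝ) : ℝ) : ℂ) ≠ 0 := by exact_mod_cast (hp _ hm.le).ne'
  simp only [polyCpow_ofReal]
  exact ((differentiable_id.neg.const_cpow (Or.inl h1)).mul
    (differentiable_id.neg.const_cpow (Or.inl h2))).mul_const _

/-- The integral of `u^(-s) cutoff(u) p(u)^(-s)` is holomorphic in `s`: it is the locally uniform
limit of its Riemann sums. -/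
theorem differentiableOn_cutIntegral (hp : ∀ x : ℝ, 0 ≤ x → 0 < p.eval x) :
    DifferentiableOn ℂ (cutIntegral p) {s | s.re < 1} := by
  have hU := isOpen_setOf_re_lt_one
  have hlim : Tendsto (fun n : ℕ => 1 / ((n : ℝ) + 1)) atTop (𝓝 0) :=
    tendsto_one_div_add_atTop_nhds_zero_nat
  have hpos : ∀ n : ℕ, 0 < 1 / ((n : ℝ) + 1) := fun n => by positivity
  have hle : ∀ n : ℕ, 1 / ((n : ℝ) + 1) ≤ 1 := fun n => by
    rw [div_le_one (by positivity)]
    linarith [(Nat.cast_nonneg n : (0 : ℝ) ≤ n)]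
  suffices hloc : TendstoLocallyUniformlyOn
      (fun (n : ℕ) s => ((1 / ((n : ℝ) + 1) : ℝ) : ℂ) * cutSum p (1 / ((n : ℝ) + 1)) s)
      (cutIntegral p) atTop {s | s.re < 1} from
    hloc.differentiableOn (Eventually.of_forall fun n =>
      ((differentiable_cutSum hp (hpos n)).const_mul _).differentiableOn) hU
  rw [tendstoLocallyUniformlyOn_iff_forall_isCompact hU]
  intro S hSU hS
  obtain ⟨σ, hσ, hσS⟩ := hS.exists_re_le_of_re_lt_one hSU
  obtain ⟨C, hC0, hC⟩ := exists_cutErr_bound hp hS hSU 0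
  have hcoef : ∀ k : ℕ, ∃ D : ℝ, 0 ≤ D ∧ ∀ s ∈ S,
      ‖taylorCoeffZero (polyCpow p (-s)) k * riemannZeta (s - k)‖ ≤ D := by
    intro k
    have hcont : ContinuousOn (fun s => taylorCoeffZero (polyCpow p (-s)) k * riemannZeta (s - k))
        S := fun s hs => ((differentiable_taylorCoeffZero_polyCpow (hp 0 le_rfl) k s).mul
          (differentiableAt_riemannZeta_sub_natCast (hSU hs) k)).continuousAt.continuousWithinAt
    obtain ⟨D, hD⟩ := hS.exists_bound_of_continuousOn hcont
    exact ⟨|D|, abs_nonneg D, fun s hs => (hD s hs).trans (le_abs_self D)⟩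
  choose D hD0 hD using hcoef
  have hkey : ∀ s ∈ S, ∀ h : ℝ, 0 < h → h ≤ 1 → ‖cutIntegral p s - (h : ℂ) * cutSum p h s‖ ≤
      (∑ k ∈ Finset.range 4, D k) * h ^ (1 - σ) + C * h := by
    intro s hs h hh h1
    have hh' : (h : ℂ) ≠ 0 := by exact_mod_cast hh.ne'
    have : cutIntegral p s - (h : ℂ) * cutSum p h s = -((h : ℂ) *
        (∑ k ∈ Finset.range 4, taylorCoeffZero (polyCpow p (-s)) k * riemannZeta (s - k) *
          (h : ℂ) ^ (-(s - k))) + (h : ℂ) * cutErr p (0 + 4) h s) := by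
      rw [cutErr, zero_add]
      field_simp
      ring
    rw [this, norm_neg]
    refine (norm_add_le _ _).trans (add_le_add ?_ ?_)
    · rw [Finset.mul_sum, Finset.sum_mul]
      refine (norm_sum_le _ _).trans (Finset.sum_le_sum fun k _ => ?_)
      rw [mul_left_comm, norm_mul]
      refine mul_le_mul (hD k s hs) ?_ (norm_nonneg _) (hD0 k)
      rw [norm_mul, Complex.norm_cpow_eq_rpow_re_of_pos hh, Complex.norm_real,
        Real.norm_of_nonneg hh.le]
      have h3 : h * h ^ (-(s - k)).re = h ^ (1 + (-(s - k)).re) := by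
        rw [Real.rpow_add hh, Real.rpow_one]
      rw [h3]
      refine Real.rpow_le_rpow_of_exponent_ge hh h1 ?_
      simp only [Complex.neg_re, Complex.sub_re, Complex.natCast_re]
      linarith [hσS s hs, (Nat.cast_nonneg k : (0 : ℝ) ≤ k)]
    · rw [norm_mul, Complex.norm_real, Real.norm_of_nonneg hh.le]
      have := hC s hs h hh h1
      rw [zero_add, pow_one] at this
      calc h * ‖cutErr p 4 h s‖ ≤ 1 * (C * h) := by gcongr
        _ = C * h := one_mul _
  rw [Metric.tendstoUniformlyOn_iff]
  intro ε hε
  have h2 : Tendsto (fun h : ℝ => (∑ k ∈ Finset.range 4, D k) * h ^ (1 - σ) + C * h)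
      (𝓝 0) (𝓝 ((∑ k ∈ Finset.range 4, D k) * 0 ^ (1 - σ) + C * 0)) :=
    ((tendsto_id.rpow_const (Or.inr (by linarith))).const_mul _).add (tendsto_id.const_mul C)
  rw [Real.zero_rpow (by linarith), mul_zero, mul_zero, add_zero] at h2
  filter_upwards [(h2.comp hlim).eventually_lt_const hε] with n hn s hs
  rw [dist_eq_norm]
  exact (hkey s hs _ (hpos n) (hle n)).trans_lt hn

theorem differentiableOn_cutErr (hp : ∀ x : ℝ, 0 ≤ x → 0 < p.eval x) (K : ℕ) {h : ℝ} (hh : 0 < h) :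
    DifferentiableOn ℂ (cutErr p K h) {s | s.re < 1} := by
  have hh' : (h : ℂ) ≠ 0 := by exact_mod_cast hh.ne'
  refine ((differentiable_cutSum hp hh).differentiableOn.sub
    ((differentiableOn_cutIntegral hp).const_mul _)).sub (DifferentiableOn.fun_sum fun k _ => ?_)
  intro s hs
  refine DifferentiableAt.differentiableWithinAt (DifferentiableAt.mul
    ((differentiable_taylorCoeffZero_polyCpow (hp 0 le_rfl) k s).mul
      (differentiableAt_riemannZeta_sub_natCast hs k)) ?_)
  exact (differentiableAt_id.sub_const _).neg.const_cpow (Or.inl hh')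

end Holomorphy

/-! ### Continuation of the half series -/

/-- The part of the half-plane `Re s < 1` where the expansion with `K + 4` correction terms
converges. -/
def expansionDomain (d K : ℕ) : Set ℂ := {s | 0 < ((d : ℝ) + 2) * s.re + K ∧ s.re < 1}

theorem isOpen_expansionDomain (d K : ℕ) : IsOpen (expansionDomain d K) :=
  (isOpen_lt continuous_const ((Complex.continuous_re.const_mul _).add_const _)).and
    isOpen_setOf_re_lt_one

theorem expansionDomain_subset_succ (d K : ℕ) : expansionDomain d K ⊆ expansionDomain d (K + 1) :=
  fun s hs => ⟨by push_cast; linarith [hs.1], hs.2⟩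

theorem convex_expansionDomain (d K : ℕ) : Convex ℝ (expansionDomain d K) := by
  have h1 : Convex ℝ {s : ℂ | -(K : ℝ) / ((d : ℝ) + 2) < s.re} := convex_halfSpace_re_gt _
  have h2 : expansionDomain d K = {s : ℂ | -(K : ℝ) / ((d : ℝ) + 2) < s.re} ∩ {s | s.re < 1} := by
    ext s
    have : (0 : ℝ) < (d : ℝ) + 2 := by positivity
    change (0 < ((d : ℝ) + 2) * s.re + K ∧ s.re < 1) ↔ (-(K : ℝ) / ((d : ℝ) + 2) < s.re ∧ s.re < 1)
    rw [div_lt_iff₀ this]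
    constructor <;> rintro ⟨h1, h2⟩ <;> exact ⟨by linarith, h2⟩
  rw [h2]
  exact h1.inter (convex_halfSpace_re_lt _)

/-- The sum over `n` of the error terms of the inner sums. -/
noncomputable def errSeries (p : Polynomial ℝ) (d K : ℕ) (s : ℂ) : ℂ :=
  ∑' n : ℕ+, (n : ℂ) ^ (-(((d : ℂ) + 2) * s)) * cutErr p (K + 4) ((n : ℝ)⁻¹) s

/-- The expansion, with `K + 4` correction terms, of the sum over `n` and `m` of the terms
`cutoff(m/n) (n^(d+1) m p(m/n))^(-s)`. -/
noncomputable def halfExpansion (p : Polynomial ℝ) (d K : ℕ) (s : ℂ) : ℂ :=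
  riemannZeta (((d : ℂ) + 2) * s - 1) * cutIntegral p s +
    (∑ k ∈ Finset.range (K + 4), taylorCoeffZero (polyCpow p (-s)) k * riemannZeta (s - k) *
      riemannZeta (((d : ℂ) + 1) * s + k)) + errSeries p d K s

section HalfSeries

variable {p : Polynomial ℝ} {d : ℕ}

theorem pnat_cast_pos (n : ℕ+) : (0 : ℝ) < n := by exact_mod_cast n.pos

theorem pnat_inv_le_one (n : ℕ+) : (n : ℝ)⁻¹ ≤ 1 :=
  inv_le_one_of_one_le₀ (by exact_mod_cast Nat.succ_le_of_lt n.pos)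

theorem summable_pnat_rpow {a : ℝ} (ha : 1 < a) : Summable fun n : ℕ+ => (n : ℝ) ^ (-a) :=
  (Real.summable_nat_rpow.2 (by linarith)).comp_injective PNat.coe_injective

theorem norm_cpow_mul_cutErr_le {C : ℝ} {K : ℕ} {s : ℂ} {n : ℕ+}
    (h : ‖cutErr p (K + 4) ((n : ℝ)⁻¹) s‖ ≤ C * ((n : ℝ)⁻¹) ^ (K + 1)) :
    ‖(n : ℂ) ^ (-(((d : ℂ) + 2) * s)) * cutErr p (K + 4) ((n : ℝ)⁻¹) s‖ ≤
      C * (n : ℝ) ^ (-((((d : ℝ) + 2) * s.re + K) + 1)) := by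
  have hn := pnat_cast_pos n
  have h1 : ‖(n : ℂ) ^ (-(((d : ℂ) + 2) * s))‖ = (n : ℝ) ^ (-(((d : ℝ) + 2) * s.re)) := by
    have := Complex.norm_cpow_eq_rpow_re_of_pos hn (-(((d : ℂ) + 2) * s))
    rw [Complex.ofReal_natCast] at this
    rw [this]
    simp
  rw [norm_mul, h1]
  refine (mul_le_mul_of_nonneg_left h (by positivity)).trans_eq ?_
  have h2 : (n : ℝ) ^ (-((((d : ℝ) + 2) * s.re + K) + 1)) =
      (n : ℝ) ^ (-(((d : ℝ) + 2) * s.re)) * ((n : ℝ)⁻¹) ^ (K + 1) := by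
    rw [inv_pow, ← Real.rpow_natCast, ← Real.rpow_neg hn.le, ← Real.rpow_add hn]
    push_cast
    ring_nf
  rw [h2]
  ring

/-- The error of the inner sum is `O(n^(-K-1))`, so the terms are
`O(n^(-(d + 2) Re s - K - 1))`. -/
theorem summable_errSeries (hp : ∀ x : ℝ, 0 ≤ x → 0 < p.eval x) {K : ℕ} {s : ℂ}
    (hs : s ∈ expansionDomain d K) : Summable fun n : ℕ+ =>
      (n : ℂ) ^ (-(((d : ℂ) + 2) * s)) * cutErr p (K + 4) ((n : ℝ)⁻¹) s := by
  obtain ⟨C, hC0, hC⟩ := exists_cutErr_bound hp (isCompact_singleton (x := s))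
    (by simpa using hs.2) K
  refine Summable.of_norm_bounded ((summable_pnat_rpow
    (by linarith [hs.1] : 1 < (((d : ℝ) + 2) * s.re + K) + 1)).mul_left C) fun n => ?_
  exact norm_cpow_mul_cutErr_le (hC s rfl _ (inv_pos.2 (pnat_cast_pos n)) (pnat_inv_le_one n))

/-- The error series is holomorphic, as it converges locally uniformly. -/
theorem differentiableOn_errSeries (hp : ∀ x : ℝ, 0 ≤ x → 0 < p.eval x) (K : ℕ) :
    DifferentiableOn ℂ (errSeries p d K) (expansionDomain d K) := by
  intro s0 hs0
  obtain ⟨r, hr, hball⟩ := Metric.nhds_basis_closedBall.mem_iff.1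
    ((isOpen_expansionDomain d K).mem_nhds hs0)
  have hcpt := isCompact_closedBall s0 r
  obtain ⟨s1, hs1, hmin⟩ := hcpt.exists_isMinOn ⟨s0, Metric.mem_closedBall_self hr.le⟩
    Complex.continuous_re.continuousOn
  obtain ⟨C, hC0, hC⟩ := exists_cutErr_bound hp hcpt (fun s hs => (hball hs).2) K
  have hd2 : (0 : ℝ) < (d : ℝ) + 2 := by positivity
  have := Complex.differentiableOn_tsum_of_summable_norm (U := Metric.ball s0 r)
    (F := fun (n : ℕ+) s => (n : ℂ) ^ (-(((d : ℂ) + 2) * s)) * cutErr p (K + 4) ((n : ℝ)⁻¹) s)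
    ((summable_pnat_rpow
      (by linarith [(hball hs1).1] : 1 < (((d : ℝ) + 2) * s1.re + K) + 1)).mul_left C)
    (fun n => ?_) Metric.isOpen_ball (fun n s hs => ?_)
  · exact (this.differentiableAt (Metric.ball_mem_nhds s0 hr)).differentiableWithinAt
  · refine DifferentiableOn.mul ?_ ((differentiableOn_cutErr hp _
      (inv_pos.2 (pnat_cast_pos n))).mono fun s hs => (hball (Metric.ball_subset_closedBall hs)).2)
    have hn : (n : ℂ) ≠ 0 := by exact_mod_cast n.ne_zero
    exact ((differentiable_id.const_mul _).neg.const_cpow (Or.inl hn)).differentiableOn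
  · have hs' := Metric.ball_subset_closedBall hs
    refine (norm_cpow_mul_cutErr_le
      (hC s hs' _ (inv_pos.2 (pnat_cast_pos n)) (pnat_inv_le_one n))).trans ?_
    refine mul_le_mul_of_nonneg_left (Real.rpow_le_rpow_of_exponent_le
      (by exact_mod_cast Nat.succ_le_of_lt n.pos) ?_) hC0
    have h3 : s1.re ≤ s.re := hmin hs'
    have := mul_le_mul_of_nonneg_left h3 hd2.le
    linarith

theorem pnat_cpow_mul_inv_cpow (n : ℕ+) (s : ℂ) (k : ℕ) :
    (n : ℂ) ^ (-(((d : ℂ) + 2) * s)) * (((n : ℝ)⁻¹ : ℝ) : ℂ) ^ (-(s - k)) =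
      (n : ℂ) ^ (-(((d : ℂ) + 1) * s + k)) := by
  have hn : (n : ℂ) ≠ 0 := by exact_mod_cast n.ne_zero
  have harg : ((n : ℂ)).arg ≠ Real.pi := by
    rw [Complex.natCast_arg]; exact Real.pi_ne_zero.symm
  rw [Complex.ofReal_inv, Complex.ofReal_natCast, Complex.inv_cpow _ _ harg, ← Complex.cpow_neg,
    ← Complex.cpow_add _ _ hn]
  ring_nf

/-- The expansions with different numbers of correction terms agree. -/
theorem halfExpansion_succ (hp : ∀ x : ℝ, 0 ≤ x → 0 < p.eval x) {K : ℕ} {s : ℂ}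
    (hs : s ∈ expansionDomain d K) : halfExpansion p d (K + 1) s = halfExpansion p d K s := by
  have hre : 1 < (((d : ℂ) + 1) * s + (K + 4 : ℕ)).re := by
    have h1 := hs.1
    have h2 := hs.2
    have : (((d : ℂ) + 1) * s + (K + 4 : ℕ)).re = ((d : ℝ) + 1) * s.re + (K + 4) := by simp
    rw [this]
    linarith
  have hz := hasSum_pnat_cpow_neg hre
  have key : errSeries p d K s = errSeries p d (K + 1) s +
      taylorCoeffZero (polyCpow p (-s)) (K + 4) * riemannZeta (s - (K + 4 : ℕ)) *
        riemannZeta (((d : ℂ) + 1) * s + (K + 4 : ℕ)) := by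
    rw [← hz.tsum_eq, ← tsum_mul_left, errSeries, errSeries,
      ← (summable_errSeries hp (expansionDomain_subset_succ d K hs)).tsum_add
        (hz.summable.mul_left _)]
    refine tsum_congr fun n => ?_
    rw [← pnat_cpow_mul_inv_cpow, cutErr, cutErr, show K + 1 + 4 = K + 4 + 1 by ring,
      Finset.sum_range_succ _ (K + 4)]
    ring
  rw [halfExpansion, halfExpansion, key, show K + 1 + 4 = K + 4 + 1 by ring,
    Finset.sum_range_succ _ (K + 4)]
  ring

theorem halfExpansion_eq_of_le (hp : ∀ x : ℝ, 0 ≤ x → 0 < p.eval x) {K K' : ℕ} (hK : K ≤ K')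
    {s : ℂ} (hs : s ∈ expansionDomain d K) : halfExpansion p d K' s = halfExpansion p d K s := by
  induction hK with
  | refl => rfl
  | @step m hm ih =>
    have : s ∈ expansionDomain d m := by
      refine ⟨?_, hs.2⟩
      have : (K : ℝ) ≤ m := by exact_mod_cast hm
      linarith [hs.1]
    rw [Nat.succ_eq_add_one, halfExpansion_succ hp this, ih]

theorem exists_mem_expansionDomain (d : ℕ) {s : ℂ} (hs : s.re < 1) :
    ∃ K : ℕ, s ∈ expansionDomain d K := by
  obtain ⟨K, hK⟩ := exists_nat_gt (-(((d : ℝ) + 2) * s.re))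
  exact ⟨K, by linarith, hs⟩

open Classical in
/-- The continuation of the half series to the half-plane `Re s < 1` (and zero elsewhere). -/
noncomputable def halfZeta (p : Polynomial ℝ) (d : ℕ) (s : ℂ) : ℂ :=
  if h : ∃ K : ℕ, s ∈ expansionDomain d K then halfExpansion p d h.choose s else 0

theorem halfZeta_eq (hp : ∀ x : ℝ, 0 ≤ x → 0 < p.eval x) {K : ℕ} {s : ℂ}
    (hs : s ∈ expansionDomain d K) : halfZeta p d s = halfExpansion p d K s := by
  have h : ∃ K : ℕ, s ∈ expansionDomain d K := ⟨K, hs⟩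
  rw [halfZeta, dif_pos h]
  rcases le_total K h.choose with hK | hK
  · exact halfExpansion_eq_of_le hp hK hs
  · exact (halfExpansion_eq_of_le hp hK h.choose_spec).symm

theorem two_div_lt_iff {s : ℂ} : 2 / ((d : ℝ) + 2) < s.re ↔ 2 < ((d : ℝ) + 2) * s.re := by
  rw [div_lt_iff₀ (by positivity), mul_comm]

/-- In the strip of convergence the half series, summed first over `m`, equals its expansion: the
main term of the inner sums gives `ζ((d + 2) s - 1)` and the `k`-th correction gives
`ζ((d + 1) s + k)`. -/
theorem hasSum_cutSum (hp : ∀ x : ℝ, 0 ≤ x → 0 < p.eval x) (hd : 1 ≤ d) {s : ℂ}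
    (hs : 2 / ((d : ℝ) + 2) < s.re) (hs1 : s.re < 1) :
    HasSum (fun n : ℕ+ => (n : ℂ) ^ (-(((d : ℂ) + 2) * s)) * cutSum p ((n : ℝ)⁻¹) s)
      (halfZeta p d s) := by
  have hs2 : 2 < ((d : ℝ) + 2) * s.re := two_div_lt_iff.1 hs
  have hmem : s ∈ expansionDomain d 0 := ⟨by simp only [Nat.cast_zero]; linarith, hs1⟩
  have hd' : (1 : ℝ) ≤ d := by exact_mod_cast hd
  have hsre : 0 < s.re := lt_trans (by positivity) hs
  have h1 : 1 < (((d : ℂ) + 2) * s - 1).re := by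
    have : (((d : ℂ) + 2) * s - 1).re = ((d : ℝ) + 2) * s.re - 1 := by simp
    rw [this]; linarith
  have h2 : ∀ k : ℕ, 1 < (((d : ℂ) + 1) * s + k).re := by
    intro k
    have : (((d : ℂ) + 1) * s + k).re = ((d : ℝ) + 1) * s.re + k := by simp
    rw [this]
    have hk : (0 : ℝ) ≤ k := Nat.cast_nonneg k
    nlinarith
  rw [halfZeta_eq hp hmem, halfExpansion]
  have e1 := (hasSum_pnat_cpow_neg h1).mul_right (cutIntegral p s)
  have e2 := hasSum_sum fun k (_ : k ∈ Finset.range (0 + 4)) =>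
    (hasSum_pnat_cpow_neg (h2 k)).mul_left
      (taylorCoeffZero (polyCpow p (-s)) k * riemannZeta (s - k))
  have e3 := (summable_errSeries (d := d) hp hmem).hasSum
  refine ((e1.add e2).add e3).congr_fun fun n => ?_
  have hn : (n : ℂ) ≠ 0 := by exact_mod_cast n.ne_zero
  have h3 : (n : ℂ) ^ (-(((d : ℂ) + 2) * s - 1)) =
      (n : ℂ) ^ (-(((d : ℂ) + 2) * s)) * n := by
    rw [neg_sub, sub_eq_neg_add, Complex.cpow_add _ _ hn, Complex.cpow_one]
  simp only [h3, ← pnat_cpow_mul_inv_cpow (d := d)]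
  rw [cutErr]
  have h4 : ∑ k ∈ Finset.range (0 + 4), taylorCoeffZero (polyCpow p (-s)) k *
      riemannZeta (s - k) * ((n : ℂ) ^ (-(((d : ℂ) + 2) * s)) *
        (((n : ℝ)⁻¹ : ℝ) : ℂ) ^ (-(s - k))) = (n : ℂ) ^ (-(((d : ℂ) + 2) * s)) *
      ∑ k ∈ Finset.range (0 + 4), taylorCoeffZero (polyCpow p (-s)) k *
        riemannZeta (s - k) * (((n : ℝ)⁻¹ : ℝ) : ℂ) ^ (-(s - k)) := by
    rw [Finset.mul_sum]
    exact Finset.sum_congr rfl fun k _ => by ring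
  rw [h4]
  push_cast
  rw [inv_inv]
  ring

end HalfSeries

/-! ### The double series -/

section DoubleSeries

variable {f p : Polynomial ℝ} {d : ℕ}

/-- The terms of the double series localised to the cone `m ≤ 2 n`, for the polynomial `p`. -/
noncomputable def halfTerm (p : Polynomial ℝ) (d : ℕ) (s : ℂ) (q : ℕ+ × ℕ+) : ℂ :=
  (cutoff ((q.2 : ℝ) / q.1) : ℂ) *
    (((q.1 : ℝ) ^ (d + 1) * q.2 * p.eval ((q.2 : ℝ) / q.1) : ℝ) : ℂ) ^ (-s)

theorem ofReal_pow_cpow {x : ℝ} (hx : 0 < x) (k : ℕ) (z : ℂ) :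
    ((x ^ k : ℝ) : ℂ) ^ z = (x : ℂ) ^ (k * z) := by
  induction k with
  | zero => simp
  | succ k ih =>
    rw [pow_succ, Complex.ofReal_mul, Complex.mul_cpow_ofReal_nonneg (by positivity) hx.le, ih,
      ← Complex.cpow_add _ _ (by exact_mod_cast hx.ne')]
    push_cast
    ring_nf

theorem halfTerm_eq (hp : ∀ x : ℝ, 0 ≤ x → 0 < p.eval x) (s : ℂ) (n m : ℕ+) :
    halfTerm p d s (n, m) = (n : ℂ) ^ (-(((d : ℂ) + 2) * s)) *
      (((m * (n : ℝ)⁻¹ : ℝ) : ℂ) ^ (-s) * polyCpow p (-s) (m * (n : ℝ)⁻¹ : ℝ) *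
        (cutoff (m * (n : ℝ)⁻¹) : ℂ)) := by
  have hn := pnat_cast_pos n
  have hm := pnat_cast_pos m
  have h1 : (n : ℝ) ^ (d + 1) * m * p.eval ((m : ℝ) / n) =
      (n : ℝ) ^ (d + 2) * ((m : ℝ) * (n : ℝ)⁻¹ * p.eval ((m : ℝ) * (n : ℝ)⁻¹)) := by
    rw [div_eq_mul_inv]
    field_simp
    ring
  have h0 : 0 ≤ (m : ℝ) * (n : ℝ)⁻¹ := by positivity
  simp only [halfTerm]
  rw [h1, Complex.ofReal_mul, Complex.mul_cpow_ofReal_nonneg (by positivity)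
    (mul_nonneg h0 (hp _ h0).le), Complex.ofReal_mul ((m : ℝ) * (n : ℝ)⁻¹),
    Complex.mul_cpow_ofReal_nonneg h0 (hp _ h0).le, ofReal_pow_cpow hn, polyCpow_ofReal,
    div_eq_mul_inv, Complex.ofReal_natCast]
  push_cast
  ring_nf

theorem hasSum_halfTerm (hp : ∀ x : ℝ, 0 ≤ x → 0 < p.eval x) (hd : 1 ≤ d) {s : ℂ}
    (hs : 2 / ((d : ℝ) + 2) < s.re) (hs1 : s.re < 1) (hsum : Summable (halfTerm p d s)) :
    HasSum (halfTerm p d s) (halfZeta p d s) := by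
  convert hsum.hasSum using 1
  rw [hsum.tsum_prod, ← (hasSum_cutSum hp hd hs hs1).tsum_eq]
  refine tsum_congr fun n => ?_
  rw [cutSum, ← tsum_mul_left]
  exact tsum_congr fun m => (halfTerm_eq hp s n m).symm

/-- The value of `f.reverse` at `0` is the leading coefficient of `f`, which is positive because
`f` is positive at infinity. -/
theorem eval_reverse_pos (hf : ∀ x : ℝ, 0 ≤ x → 0 < f.eval x) (x : ℝ) (hx : 0 ≤ x) :
    0 < f.reverse.eval x := by
  rcases hx.eq_or_lt with rfl | hx
  · rw [← Polynomial.coeff_zero_eq_eval_zero, Polynomial.coeff_zero_reverse]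
    by_contra hneg
    rcases lt_or_ge 0 f.degree with hdeg | hdeg
    · have h1 := f.tendsto_atBot_of_leadingCoeff_nonpos hdeg (not_lt.1 hneg)
      obtain ⟨x, hx, hx0⟩ := ((h1.eventually_lt_atBot 0).and (eventually_ge_atTop 0)).exists
      exact absurd (hf x hx0) (not_lt.2 hx.le)
    · have h1 := hf 0 le_rfl
      rw [Polynomial.eq_C_of_degree_le_zero hdeg] at h1 hneg
      simp only [Polynomial.eval_C, Polynomial.leadingCoeff_C] at h1 hneg
      exact hneg h1
  · rw [reverse_eval_eq f x hx.ne']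
    exact mul_pos (by positivity) (hf _ (by positivity))

theorem reverse_base_eq (f : Polynomial ℝ) (n m : ℕ+) :
    (n : ℝ) ^ (f.natDegree + 1) * m * f.reverse.eval ((m : ℝ) / n) =
      n * (m : ℝ) ^ (f.natDegree + 1) * f.eval ((n : ℝ) / m) := by
  have hn := pnat_cast_pos n
  have hm := pnat_cast_pos m
  rw [reverse_eval_eq f _ (by positivity), one_div_div, div_pow]
  field_simp
  ring

/-- The decomposition of the double series by `cutoff(m/n) + cutoff(n/m) = 1`: near the axis
`m = 0` the term is expressed by the reciprocal polynomial, near `n = 0` by `f`. -/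
theorem zetaTerm_eq_halfTerm_add (s : ℂ) (n m : ℕ+) :
    zetaTerm f s (n, m) = halfTerm f.reverse f.natDegree s (n, m) +
      halfTerm f f.natDegree s (m, n) := by
  have hn := pnat_cast_pos n
  have hm := pnat_cast_pos m
  have h2 : (m : ℝ) ^ (f.natDegree + 1) * n * f.eval ((n : ℝ) / m) =
      n * (m : ℝ) ^ (f.natDegree + 1) * f.eval ((n : ℝ) / m) := by ring
  have h3 : (cutoff ((m : ℝ) / n) : ℂ) + (cutoff ((n : ℝ) / m) : ℂ) = 1 := by
    have := cutoff_add_cutoff_inv (u := (m : ℝ) / n) (v := (n : ℝ) / m) (by positivity)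
      (by field_simp)
    exact_mod_cast this
  simp only [halfTerm, zetaTerm]
  rw [reverse_base_eq, h2, ← add_mul, h3, one_mul]

theorem exists_const_le_eval (hp : ∀ x : ℝ, 0 ≤ x → 0 < p.eval x) :
    ∃ c : ℝ, 0 < c ∧ ∀ x ∈ Set.Icc (0 : ℝ) 1, c ≤ p.eval x := by
  obtain ⟨x0, hx0, hmin⟩ := (isCompact_Icc (a := (0 : ℝ)) (b := 1)).exists_isMinOn
    ⟨0, by simp⟩ p.continuous.continuousOn
  exact ⟨p.eval x0, hp x0 hx0.1, fun x hx => hmin hx⟩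

/-- By the inequality of arithmetic and geometric means, the base of the terms dominates a power
of the product `n m`. -/
theorem exists_base_ge (hf : ∀ x : ℝ, 0 ≤ x → 0 < f.eval x) :
    ∃ c : ℝ, 0 < c ∧ c ≤ 1 ∧ ∀ n m : ℕ+, c * ((n : ℝ) * m) ^ (((f.natDegree : ℝ) + 2) / 2) ≤
      n * (m : ℝ) ^ (f.natDegree + 1) * f.eval ((n : ℝ) / m) := by
  obtain ⟨c1, hc1, h1⟩ := exists_const_le_eval hf
  obtain ⟨c2, hc2, h2⟩ := exists_const_le_eval (eval_reverse_pos hf)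
  set d := f.natDegree with hd
  set c := min (min c1 c2) 1 with hc
  have hcc1 : c ≤ c1 := (min_le_left _ _).trans (min_le_left _ _)
  have hcc2 : c ≤ c2 := (min_le_left _ _).trans (min_le_right _ _)
  have hc0 : 0 < c := lt_min (lt_min hc1 hc2) one_pos
  refine ⟨c, hc0, min_le_right _ _, fun n m => ?_⟩
  have hn := pnat_cast_pos n
  have hm := pnat_cast_pos m
  have hpow : ∀ k : ℝ, 0 < k → (n : ℝ) * m ≤ k ^ 2 →
      ((n : ℝ) * m) ^ (((d : ℝ) + 2) / 2) ≤ n * m * k ^ d := by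
    intro k hk hle
    have e1 : ((n : ℝ) * m) ^ (((d : ℝ) + 2) / 2) = n * m * ((n : ℝ) * m) ^ ((d : ℝ) / 2) := by
      rw [show ((d : ℝ) + 2) / 2 = 1 + d / 2 by ring, Real.rpow_add (by positivity), Real.rpow_one]
    rw [e1]
    refine mul_le_mul_of_nonneg_left ?_ (by positivity)
    refine (Real.rpow_le_rpow (by positivity) hle (by positivity)).trans_eq ?_
    rw [← Real.rpow_natCast k 2, ← Real.rpow_mul hk.le, ← Real.rpow_natCast k d]
    congr 1
    push_cast
    ring
  rcases le_total (n : ℝ) m with hnm | hnm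
  · have e1 : c ≤ f.eval ((n : ℝ) / m) :=
      hcc1.trans (h1 _ ⟨by positivity, (div_le_one hm).2 hnm⟩)
    calc c * ((n : ℝ) * m) ^ (((d : ℝ) + 2) / 2) ≤ c * (n * m * (m : ℝ) ^ d) :=
          mul_le_mul_of_nonneg_left (hpow m hm (by nlinarith)) hc0.le
      _ = n * (m : ℝ) ^ (d + 1) * c := by ring
      _ ≤ _ := mul_le_mul_of_nonneg_left e1 (by positivity)
  · have e1 : c ≤ f.reverse.eval ((m : ℝ) / n) :=
      hcc2.trans (h2 _ ⟨by positivity, (div_le_one hn).2 hnm⟩)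
    rw [reverse_eval_eq f _ (by positivity), one_div_div] at e1
    calc c * ((n : ℝ) * m) ^ (((d : ℝ) + 2) / 2) ≤ c * (n * m * (n : ℝ) ^ d) :=
          mul_le_mul_of_nonneg_left (hpow n hn (by nlinarith)) hc0.le
      _ = (n * m * (n : ℝ) ^ d) * c := by ring
      _ ≤ (n * m * (n : ℝ) ^ d) * (((m : ℝ) / n) ^ d * f.eval ((n : ℝ) / m)) :=
          mul_le_mul_of_nonneg_left e1 (by positivity)
      _ = _ := by rw [div_pow]; field_simp; ring

theorem exists_norm_zetaTerm_le (hf : ∀ x : ℝ, 0 ≤ x → 0 < f.eval x) {σ₁ σ₂ : ℝ} (h0 : 0 < σ₁) :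
    ∃ C : ℝ, 0 ≤ C ∧ ∀ s : ℂ, σ₁ ≤ s.re → s.re ≤ σ₂ → ∀ q : ℕ+ × ℕ+, ‖zetaTerm f s q‖ ≤
      C * ((q.1 : ℝ) ^ (-(((f.natDegree : ℝ) + 2) / 2 * σ₁)) *
        (q.2 : ℝ) ^ (-(((f.natDegree : ℝ) + 2) / 2 * σ₁))) := by
  obtain ⟨c, hc0, hc1, hc⟩ := exists_base_ge hf
  refine ⟨c ^ (-σ₂), by positivity, fun s hs1 hs2 q => ?_⟩
  obtain ⟨n, m⟩ := q
  have hn := pnat_cast_pos n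
  have hm := pnat_cast_pos m
  have hA : 1 ≤ (n : ℝ) * m := one_le_mul_of_one_le_of_one_le
    (by exact_mod_cast Nat.succ_le_of_lt n.pos) (by exact_mod_cast Nat.succ_le_of_lt m.pos)
  have hA0 : 0 < (n : ℝ) * m := by positivity
  have hb := hc n m
  have hlow : 0 < c * ((n : ℝ) * m) ^ (((f.natDegree : ℝ) + 2) / 2) := by positivity
  simp only [zetaTerm]
  rw [Complex.norm_cpow_eq_rpow_re_of_pos (hlow.trans_le hb), Complex.neg_re,
    ← Real.mul_rpow hn.le hm.le]
  calc _ ≤ (c * ((n : ℝ) * m) ^ (((f.natDegree : ℝ) + 2) / 2)) ^ (-s.re) :=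
        Real.rpow_le_rpow_of_nonpos hlow hb (by linarith)
    _ = c ^ (-s.re) * ((n : ℝ) * m) ^ (-(((f.natDegree : ℝ) + 2) / 2 * s.re)) := by
        rw [Real.mul_rpow hc0.le (by positivity), ← Real.rpow_mul hA0.le]
        ring_nf
    _ ≤ _ := by
        refine mul_le_mul (Real.rpow_le_rpow_of_exponent_ge hc0 hc1 (by linarith))
          (Real.rpow_le_rpow_of_exponent_le hA ?_) (by positivity) (by positivity)
        exact neg_le_neg (mul_le_mul_of_nonneg_left hs1 (by positivity))

theorem summable_pnat_prod_rpow {a : ℝ} (ha : 1 < a) :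
    Summable fun q : ℕ+ × ℕ+ => (q.1 : ℝ) ^ (-a) * (q.2 : ℝ) ^ (-a) :=
  (summable_pnat_rpow ha).mul_of_nonneg (summable_pnat_rpow ha)
    (fun n => by positivity) fun n => by positivity

theorem one_lt_half_mul {σ : ℝ} (h : 2 / ((d : ℝ) + 2) < σ) : 1 < ((d : ℝ) + 2) / 2 * σ := by
  rw [div_lt_iff₀ (by positivity)] at h
  linarith

theorem summable_zetaTerm (hf : ∀ x : ℝ, 0 ≤ x → 0 < f.eval x) {s : ℂ}
    (hs : 2 / ((f.natDegree : ℝ) + 2) < s.re) : Summable (zetaTerm f s) := by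
  obtain ⟨C, hC0, hC⟩ := exists_norm_zetaTerm_le hf (σ₁ := s.re) (σ₂ := s.re)
    (lt_trans (by positivity) hs)
  exact Summable.of_norm_bounded ((summable_pnat_prod_rpow (one_lt_half_mul hs)).mul_left C)
    (hC s le_rfl le_rfl)

theorem differentiableOn_tsum_zetaTerm (hf : ∀ x : ℝ, 0 ≤ x → 0 < f.eval x) :
    DifferentiableOn ℂ (fun s => ∑' q, zetaTerm f s q)
      {s | 2 / ((f.natDegree : ℝ) + 2) < s.re} := by
  intro s0 hs0
  obtain ⟨σ, hσ, hσ0⟩ := exists_between (show 2 / ((f.natDegree : ℝ) + 2) < s0.re from hs0)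
  obtain ⟨C, hC0, hC⟩ := exists_norm_zetaTerm_le hf (σ₁ := σ) (σ₂ := s0.re + 1)
    (lt_trans (by positivity) hσ)
  have hU : IsOpen ({s : ℂ | σ < s.re} ∩ {s : ℂ | s.re < s0.re + 1}) :=
    (isOpen_lt continuous_const Complex.continuous_re).inter
      (isOpen_lt Complex.continuous_re continuous_const)
  have := Complex.differentiableOn_tsum_of_summable_norm (F := fun q s => zetaTerm f s q)
    ((summable_pnat_prod_rpow (one_lt_half_mul hσ)).mul_left C) (fun q => ?_) hU
    (fun q s hs => hC s (le_of_lt hs.1) (le_of_lt hs.2) q)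
  · exact (this.differentiableAt (hU.mem_nhds ⟨hσ0, by simp⟩)).differentiableWithinAt
  · obtain ⟨n, m⟩ := q
    have hn := pnat_cast_pos n
    have hm := pnat_cast_pos m
    have hpos : 0 < (n : ℝ) * (m : ℝ) ^ (f.natDegree + 1) * f.eval ((n : ℝ) / m) :=
      mul_pos (by positivity) (hf _ (by positivity))
    have hne : (((n : ℝ) * (m : ℝ) ^ (f.natDegree + 1) * f.eval ((n : ℝ) / m) : ℝ) : ℂ) ≠ 0 := by
      exact_mod_cast hpos.ne'
    exact (differentiable_id.neg.const_cpow (Or.inl hne)).differentiableOn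

theorem summable_halfTerm (hf : ∀ x : ℝ, 0 ≤ x → 0 < f.eval x) {s : ℂ}
    (hs : 2 / ((f.natDegree : ℝ) + 2) < s.re) :
    Summable (halfTerm f.reverse f.natDegree s) ∧ Summable (halfTerm f f.natDegree s) := by
  have hz := summable_zetaTerm hf hs
  have hle : ∀ (u : ℝ) (z : ℂ), ‖(cutoff u : ℂ) * z‖ ≤ ‖z‖ := fun u z => by
    rw [norm_mul, Complex.norm_real, Real.norm_of_nonneg (cutoff_nonneg _)]
    exact mul_le_of_le_one_left (norm_nonneg _) (cutoff_le_one _)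
  constructor
  · refine Summable.of_norm_bounded hz.norm fun q => ?_
    obtain ⟨n, m⟩ := q
    have hn := pnat_cast_pos n
    have hm := pnat_cast_pos m
    simp only [halfTerm, zetaTerm]
    rw [reverse_base_eq]
    exact hle _ _
  · refine Summable.of_norm_bounded ((Equiv.prodComm ℕ+ ℕ+).summable_iff.2 hz).norm fun q => ?_
    obtain ⟨m, n⟩ := q
    have h2 : (m : ℝ) ^ (f.natDegree + 1) * n * f.eval ((n : ℝ) / m) =
        n * (m : ℝ) ^ (f.natDegree + 1) * f.eval ((n : ℝ) / m) := by ring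
    simp only [halfTerm, zetaTerm, Function.comp_apply, Equiv.prodComm_apply, Prod.swap_prod_mk]
    rw [h2]
    exact hle _ _

theorem hasSum_zetaTerm (hf : ∀ x : ℝ, 0 ≤ x → 0 < f.eval x) (hd : 1 ≤ f.natDegree) {s : ℂ}
    (hs : 2 / ((f.natDegree : ℝ) + 2) < s.re) (hs1 : s.re < 1) :
    HasSum (zetaTerm f s) (halfZeta f.reverse f.natDegree s + halfZeta f f.natDegree s) := by
  obtain ⟨h1, h2⟩ := summable_halfTerm hf hs
  have e1 := hasSum_halfTerm (eval_reverse_pos hf) hd hs hs1 h1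
  have e2 := (Equiv.prodComm ℕ+ ℕ+).hasSum_iff.2 (hasSum_halfTerm hf hd hs hs1 h2)
  exact (e1.add e2).congr_fun fun q => zetaTerm_eq_halfTerm_add s q.1 q.2

end DoubleSeries

/-! ### Meromorphic functions on the plane -/

theorem meromorphicAt_riemannZeta (z : ℂ) : MeromorphicAt riemannZeta z := by
  rcases ne_or_eq z 1 with hz | rfl
  · refine AnalyticAt.meromorphicAt (DifferentiableOn.analyticAt (s := {1}ᶜ)
      (fun w hw => (differentiableAt_riemannZeta hw).differentiableWithinAt)
      (isOpen_compl_singleton.mem_nhds hz))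
  · have h1 : MeromorphicAt (fun s => (completedRiemannZeta₀ s - 1 / s - 1 / (1 - s)) *
        (Complex.Gammaℝ s)⁻¹) 1 := by
      refine MeromorphicAt.mul (((differentiable_completedZeta₀.analyticAt 1).meromorphicAt.sub
        ((MeromorphicAt.const 1 1).div (MeromorphicAt.id 1))).sub
        ((MeromorphicAt.const 1 1).div ((MeromorphicAt.const 1 1).sub (MeromorphicAt.id 1)))) ?_
      exact (Complex.differentiable_Gammaℝ_inv.analyticAt 1).meromorphicAt
    refine h1.congr (Filter.Eventually.filter_mono nhdsWithin_le_nhds ?_)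
    filter_upwards [isOpen_ne.mem_nhds (one_ne_zero (α := ℂ))] with s hs
    rw [riemannZeta_def_of_ne_zero hs, completedRiemannZeta_eq]
    exact (div_eq_mul_inv _ _).symm

/-- The identity theorem for meromorphic functions. -/
theorem MeromorphicOn.eventuallyEq_nhdsNE_of_isPreconnected {F G : ℂ → ℂ} {U : Set ℂ}
    (hF : MeromorphicOn F U) (hG : MeromorphicOn G U) (hU : IsPreconnected U) {s₁ s₀ : ℂ}
    (h1 : s₁ ∈ U) (h0 : s₀ ∈ U) (h : F =ᶠ[𝓝 s₁] G) : F =ᶠ[𝓝[≠] s₀] G := by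
  have hFG : MeromorphicOn (F - G) U := hF.sub hG
  have htop : meromorphicOrderAt (F - G) s₁ = ⊤ := by
    rw [meromorphicOrderAt_eq_top_iff]
    refine Filter.Eventually.filter_mono nhdsWithin_le_nhds ?_
    filter_upwards [h] with s hs
    simp [hs]
  have h2 : meromorphicOrderAt (F - G) s₀ = ⊤ := by
    by_contra hne
    exact hFG.meromorphicOrderAt_ne_top_of_isPreconnected hU h0 h1 hne htop
  rw [meromorphicOrderAt_eq_top_iff] at h2
  filter_upwards [h2] with s hs
  exact sub_eq_zero.1 hs

theorem not_hasPoleAt_of_eventuallyEq {Z W : ℂ → ℂ} {s₀ : ℂ} (h : Z =ᶠ[𝓝[≠] s₀] W)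
    (hZ : MeromorphicAt Z s₀) (hW : ContinuousAt W s₀) : ¬ HasPoleAt Z s₀ := by
  rw [HasPoleAt, not_lt, ← tendsto_nhds_iff_meromorphicOrderAt_nonneg hZ]
  exact ⟨W s₀, (hW.tendsto.mono_left nhdsWithin_le_nhds).congr' h.symm⟩

theorem meromorphicOrderAt_sub_mul {Z : ℂ → ℂ} {s₀ : ℂ} (hZ : MeromorphicAt Z s₀) :
    MeromorphicAt (fun s => (s - s₀) * Z s) s₀ ∧
      meromorphicOrderAt (fun s => (s - s₀) * Z s) s₀ = 1 + meromorphicOrderAt Z s₀ := by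
  have h1 : MeromorphicAt (fun s => s - s₀) s₀ :=
    (MeromorphicAt.id s₀).sub (MeromorphicAt.const s₀ s₀)
  refine ⟨h1.mul hZ, ?_⟩
  refine (meromorphicOrderAt_mul h1 hZ).trans ?_
  rw [meromorphicOrderAt_id_sub_const]

theorem neg_one_le_meromorphicOrderAt {Z : ℂ → ℂ} {s₀ r : ℂ} (hZ : MeromorphicAt Z s₀)
    (h : Tendsto (fun s => (s - s₀) * Z s) (𝓝[≠] s₀) (𝓝 r)) :
    ((-1 : ℤ) : WithTop ℤ) ≤ meromorphicOrderAt Z s₀ := by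
  obtain ⟨h1, h2⟩ := meromorphicOrderAt_sub_mul hZ
  have h3 := (tendsto_nhds_iff_meromorphicOrderAt_nonneg h1).1 ⟨r, h⟩
  rw [h2] at h3
  cases ho : meromorphicOrderAt Z s₀ with
  | top => exact le_top
  | coe n =>
    rw [ho] at h3
    have : (0 : ℤ) ≤ 1 + n := by exact_mod_cast h3
    exact_mod_cast (by omega : -1 ≤ n)

theorem not_hasPoleAt_of_tendsto_zero {Z : ℂ → ℂ} {s₀ : ℂ} (hZ : MeromorphicAt Z s₀)
    (h : Tendsto (fun s => (s - s₀) * Z s) (𝓝[≠] s₀) (𝓝 0)) : ¬ HasPoleAt Z s₀ := by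
  obtain ⟨h1, h2⟩ := meromorphicOrderAt_sub_mul hZ
  have h3 := (tendsto_zero_iff_meromorphicOrderAt_pos h1).1 h
  rw [h2] at h3
  rw [HasPoleAt, not_lt]
  cases ho : meromorphicOrderAt Z s₀ with
  | top => exact le_top
  | coe n =>
    rw [ho] at h3
    have : (0 : ℤ) < 1 + n := by exact_mod_cast h3
    exact_mod_cast (by omega : 0 ≤ n)

/-! ### Poles of the expansion -/

section Poles

variable {p f : Polynomial ℝ} {d : ℕ}

theorem meromorphicOn_halfExpansion (hp : ∀ x : ℝ, 0 ≤ x → 0 < p.eval x) (d K : ℕ) :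
    MeromorphicOn (halfExpansion p d K) (expansionDomain d K) := by
  intro s hs
  have hopen := isOpen_expansionDomain d K
  have hI : AnalyticAt ℂ (cutIntegral p) s :=
    (differentiableOn_cutIntegral hp).analyticAt (isOpen_setOf_re_lt_one.mem_nhds hs.2)
  have hE : AnalyticAt ℂ (errSeries p d K) s :=
    (differentiableOn_errSeries hp K).analyticAt (hopen.mem_nhds hs)
  refine MeromorphicAt.add (MeromorphicAt.add (MeromorphicAt.mul ?_ hI.meromorphicAt)
    (MeromorphicAt.fun_sum fun k _ => MeromorphicAt.mul (MeromorphicAt.mul ?_ ?_) ?_))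
    hE.meromorphicAt
  · exact (meromorphicAt_riemannZeta _).comp_analyticAt
      (f := riemannZeta) (g := fun s => ((d : ℂ) + 2) * s - 1) (by fun_prop)
  · exact ((differentiable_taylorCoeffZero_polyCpow (hp 0 le_rfl) k).analyticAt s).meromorphicAt
  · exact (meromorphicAt_riemannZeta _).comp_analyticAt
      (f := riemannZeta) (g := fun s => s - (k : ℂ)) (by fun_prop)
  · exact (meromorphicAt_riemannZeta _).comp_analyticAt
      (f := riemannZeta) (g := fun s => ((d : ℂ) + 1) * s + k) (by fun_prop)

/-- The product of zeta values in the `k`-th correction term is continuous away from the solution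
of `(d + 1) s + k = 1`. -/
theorem continuousAt_correction (hp : ∀ x : ℝ, 0 ≤ x → 0 < p.eval x) {s₀ : ℂ} (hs : s₀.re < 1)
    {k : ℕ} (hk : ((d : ℂ) + 1) * s₀ + k ≠ 1) :
    ContinuousAt (fun s => taylorCoeffZero (polyCpow p (-s)) k * riemannZeta (s - k) *
      riemannZeta (((d : ℂ) + 1) * s + k)) s₀ := by
  refine ContinuousAt.mul ((differentiable_taylorCoeffZero_polyCpow (hp 0 le_rfl) k
    s₀).continuousAt.mul (differentiableAt_riemannZeta_sub_natCast hs k).continuousAt) ?_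
  exact ContinuousAt.comp (f := fun s => ((d : ℂ) + 1) * s + k) (g := riemannZeta)
    (differentiableAt_riemannZeta hk).continuousAt (by fun_prop)

theorem continuousAt_main_add_errSeries (hp : ∀ x : ℝ, 0 ≤ x → 0 < p.eval x) {K : ℕ} {s₀ : ℂ}
    (hs : s₀ ∈ expansionDomain d K) (h2 : ((d : ℂ) + 2) * s₀ ≠ 2) :
    ContinuousAt (fun s => riemannZeta (((d : ℂ) + 2) * s - 1) * cutIntegral p s) s₀ ∧
      ContinuousAt (errSeries p d K) s₀ := by
  refine ⟨ContinuousAt.mul ?_ ?_, ?_⟩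
  · have h3 : ((d : ℂ) + 2) * s₀ - 1 ≠ 1 := fun h => h2 (by linear_combination h)
    exact ContinuousAt.comp (f := fun s => ((d : ℂ) + 2) * s - 1) (g := riemannZeta)
      (differentiableAt_riemannZeta h3).continuousAt (by fun_prop)
  · exact ((differentiableOn_cutIntegral hp).differentiableAt
      (isOpen_setOf_re_lt_one.mem_nhds hs.2)).continuousAt
  · exact ((differentiableOn_errSeries hp K).differentiableAt
      ((isOpen_expansionDomain d K).mem_nhds hs)).continuousAt

theorem continuousAt_halfExpansion (hp : ∀ x : ℝ, 0 ≤ x → 0 < p.eval x) {K : ℕ} {s₀ : ℂ}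
    (hs : s₀ ∈ expansionDomain d K) (h2 : ((d : ℂ) + 2) * s₀ ≠ 2)
    (hk : ∀ k : ℕ, ((d : ℂ) + 1) * s₀ + k ≠ 1) : ContinuousAt (halfExpansion p d K) s₀ := by
  obtain ⟨h3, h4⟩ := continuousAt_main_add_errSeries hp hs h2
  exact (h3.add (tendsto_finsetSum _ fun k _ => continuousAt_correction hp hs.2 (hk k))).add h4

theorem tendsto_sub_mul_of_continuousAt {F : ℂ → ℂ} {s₀ : ℂ} (hF : ContinuousAt F s₀) :
    Tendsto (fun s => (s - s₀) * F s) (𝓝[≠] s₀) (𝓝 0) := by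
  have : Tendsto (fun s => (s - s₀) * F s) (𝓝 s₀) (𝓝 ((s₀ - s₀) * F s₀)) :=
    ((continuous_id.sub continuous_const).tendsto s₀).mul hF
  rw [sub_self, zero_mul] at this
  exact this.mono_left nhdsWithin_le_nhds

theorem tendsto_sub_mul_riemannZeta {n : ℕ} {s₀ : ℂ} (hn : ((d : ℂ) + 1) * s₀ - 1 = -(n : ℂ)) :
    Tendsto (fun s => (s - s₀) * riemannZeta (((d : ℂ) + 1) * s + n)) (𝓝[≠] s₀)
      (𝓝 (1 / ((d : ℂ) + 1))) := by
  have hd : (d : ℂ) + 1 ≠ 0 := by exact_mod_cast d.succ_ne_zero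
  have hval : ∀ s, ((d : ℂ) + 1) * s + n - 1 = ((d : ℂ) + 1) * (s - s₀) := fun s => by
    linear_combination hn
  have h1 : Tendsto (fun s => ((d : ℂ) + 1) * s + n) (𝓝[≠] s₀) (𝓝[≠] 1) := by
    refine tendsto_nhdsWithin_iff.2 ⟨?_, ?_⟩
    · have : Tendsto (fun s => ((d : ℂ) + 1) * s + n) (𝓝 s₀) (𝓝 (((d : ℂ) + 1) * s₀ + n)) :=
        (by fun_prop : Continuous fun s => ((d : ℂ) + 1) * s + n).tendsto s₀
      rw [show ((d : ℂ) + 1) * s₀ + n = 1 by linear_combination hn] at this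
      exact this.mono_left nhdsWithin_le_nhds
    · filter_upwards [self_mem_nhdsWithin] with s (hs : s ≠ s₀)
      intro h
      have h2 := hval s
      rw [show ((d : ℂ) + 1) * s + n = 1 from h, sub_self] at h2
      exact (mul_ne_zero hd (sub_ne_zero.2 hs)) h2.symm
  have h2 := (riemannZeta_residue_one.comp h1).const_mul (1 / ((d : ℂ) + 1))
  rw [mul_one] at h2
  refine h2.congr fun s => ?_
  rw [Function.comp_apply, hval]
  field_simp

/-- At `s₀ = (1 - n) / (d + 1)` only the `n`-th correction term has a pole, and
`s₀ - n = (d + 2) s₀ - 1` there. -/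
theorem tendsto_sub_mul_halfExpansion (hp : ∀ x : ℝ, 0 ≤ x → 0 < p.eval x) {K n : ℕ} (hnK : n ≤ K)
    {s₀ : ℂ} (hs : s₀ ∈ expansionDomain d K) (h2 : ((d : ℂ) + 2) * s₀ ≠ 2)
    (hn : ((d : ℂ) + 1) * s₀ - 1 = -(n : ℂ)) :
    Tendsto (fun s => (s - s₀) * halfExpansion p d K s) (𝓝[≠] s₀)
      (𝓝 (riemannZeta (((d : ℂ) + 2) * s₀ - 1) / ((d : ℂ) + 1) *
        taylorCoeffZero (polyCpow p (-s₀)) n)) := by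
  obtain ⟨h3, h4⟩ := continuousAt_main_add_errSeries hp hs h2
  have hrest : ContinuousAt (fun s => riemannZeta (((d : ℂ) + 2) * s - 1) * cutIntegral p s +
      (∑ k ∈ (Finset.range (K + 4)).erase n, taylorCoeffZero (polyCpow p (-s)) k *
        riemannZeta (s - k) * riemannZeta (((d : ℂ) + 1) * s + k)) + errSeries p d K s) s₀ := by
    refine (h3.add (tendsto_finsetSum _ fun k hk => continuousAt_correction hp hs.2 ?_)).add h4
    intro h
    have : (k : ℂ) = n := by linear_combination h - hn
    exact Finset.ne_of_mem_erase hk (by exact_mod_cast this)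
  have hpole : Tendsto (fun s => taylorCoeffZero (polyCpow p (-s)) n * riemannZeta (s - n) *
      ((s - s₀) * riemannZeta (((d : ℂ) + 1) * s + n))) (𝓝[≠] s₀)
      (𝓝 (taylorCoeffZero (polyCpow p (-s₀)) n * riemannZeta (s₀ - n) * (1 / ((d : ℂ) + 1)))) := by
    refine Tendsto.mul (Tendsto.mono_left ?_ nhdsWithin_le_nhds) (tendsto_sub_mul_riemannZeta hn)
    exact (differentiable_taylorCoeffZero_polyCpow (hp 0 le_rfl) n s₀).continuousAt.mul
      (differentiableAt_riemannZeta_sub_natCast hs.2 n).continuousAt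
  have := (tendsto_sub_mul_of_continuousAt hrest).add hpole
  rw [zero_add, show s₀ - n = ((d : ℂ) + 2) * s₀ - 1 by linear_combination -hn] at this
  rw [div_eq_mul_one_div]
  refine (this.congr fun s => ?_).congr' EventuallyEq.rfl |>.trans (le_of_eq (by ring_nf))
  rw [halfExpansion, ← Finset.add_sum_erase _ _ (Finset.mem_range.2 (by omega : n < K + 4))]
  ring

/-- At an integer `s₀ = -j ≤ 0` the function `p^(-s₀)` is a polynomial of degree at most `d j`, so
its coefficient of order `n = 1 + (d + 1) j` vanishes. -/
theorem taylorCoeffZero_polyCpow_eq_zero {j n : ℕ} (hdeg : p.natDegree * j < n) :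
    taylorCoeffZero (polyCpow p (j : ℂ)) n = 0 := by
  have h1 : polyCpow p (j : ℂ) = fun x => ((p.map (algebraMap ℝ ℂ)) ^ j).eval x := by
    funext x
    rw [polyCpow, Complex.cpow_natCast, Polynomial.eval_pow, Polynomial.eval_map_algebraMap]
  have h2 : ∀ (k : ℕ) (q : Polynomial ℂ),
      iteratedDeriv k (fun x => q.eval x) = fun x => (Polynomial.derivative^[k] q).eval x := by
    intro k
    induction k with
    | zero => intro q; simp
    | succ k ih =>
      intro q
      rw [iteratedDeriv_succ', Function.iterate_succ_apply, ← ih]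
      congr 1
      funext x
      exact q.deriv
  rw [taylorCoeffZero, h1, h2, Polynomial.iterate_derivative_eq_zero]
  · simp
  · refine lt_of_le_of_lt (Polynomial.natDegree_pow_le.trans ?_) hdeg
    rw [mul_comm]
    exact Nat.mul_le_mul_right j Polynomial.natDegree_map_le

theorem residueValue_eq_zero_of_int (hd : 1 ≤ f.natDegree) {k : ℤ} {n : ℕ}
    (hn : ((f.natDegree : ℂ) + 1) * (k : ℂ) - 1 = -(n : ℂ)) : residueValue f (k : ℂ) n = 0 := by
  have hn' : ((f.natDegree : ℤ) + 1) * k - 1 = -(n : ℤ) := by exact_mod_cast hn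
  have hk : k ≤ 0 := by
    by_contra h
    have h1 : (1 : ℤ) ≤ k := by omega
    have h2 : (1 : ℤ) ≤ f.natDegree := by exact_mod_cast hd
    have h3 : (0 : ℤ) ≤ n := Int.natCast_nonneg n
    nlinarith
  obtain ⟨j, hj⟩ := Int.eq_ofNat_of_zero_le (neg_nonneg.2 hk)
  obtain rfl : k = -(j : ℤ) := by omega
  have hnj : n = 1 + (f.natDegree + 1) * j := by
    have : (n : ℤ) = 1 + ((f.natDegree : ℤ) + 1) * j := by linarith
    exact_mod_cast this
  have hlt : f.natDegree * j < n := by rw [hnj, add_mul]; omega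
  have hlt' : f.reverse.natDegree * j < n :=
    (Nat.mul_le_mul_right j (Polynomial.reverse_natDegree_le f)).trans_lt hlt
  have hcast : -(((-(j : ℤ) : ℤ)) : ℂ) = (j : ℂ) := by push_cast; ring
  rw [residueValue, hcast, taylorCoeffZero_polyCpow_eq_zero hlt,
    taylorCoeffZero_polyCpow_eq_zero hlt', add_zero, mul_zero]

end Poles

/-! ### Continuations of the double series -/

section Continuation

variable {f : Polynomial ℝ} {Z : ℂ → ℂ}

theorem isOpen_convergence (d : ℕ) : IsOpen {s : ℂ | 2 / ((d : ℝ) + 2) < s.re} :=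
  isOpen_lt continuous_const Complex.continuous_re

theorem two_div_lt_one {d : ℕ} (hd : 1 ≤ d) : 2 / ((d : ℝ) + 2) < 1 := by
  rw [div_lt_one (by positivity)]
  have : (1 : ℝ) ≤ d := by exact_mod_cast hd
  linarith

/-- Any two continuations agree near the point `s₀`, except possibly at `s₀`. -/
theorem IsZetaContinuation.eventuallyEq {Z' : ℂ → ℂ} (hZ : IsZetaContinuation f Z)
    (hZ' : IsZetaContinuation f Z') (s₀ : ℂ) : Z =ᶠ[𝓝[≠] s₀] Z' := by
  refine MeromorphicOn.eventuallyEq_nhdsNE_of_isPreconnected (U := Set.univ)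
    (s₁ := 2) (fun s _ => hZ.meromorphic s) (fun s _ => hZ'.meromorphic s) isPreconnected_univ
    (Set.mem_univ _) (Set.mem_univ _) ?_
  have h2 : (2 : ℂ) ∈ {s : ℂ | 2 / ((f.natDegree : ℝ) + 2) < s.re} := by
    have : 2 / ((f.natDegree : ℝ) + 2) < 2 := by
      rw [div_lt_iff₀ (by positivity)]
      linarith [(Nat.cast_nonneg f.natDegree : (0 : ℝ) ≤ f.natDegree)]
    exact this
  filter_upwards [(isOpen_convergence f.natDegree).mem_nhds h2] with s hs
  exact (hZ.hasSum s hs).unique (hZ'.hasSum s hs)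

theorem IsZetaContinuation.eventuallyEq_tsum (hZ : IsZetaContinuation f Z) {s₀ : ℂ}
    (hs : 2 / ((f.natDegree : ℝ) + 2) < s₀.re) : Z =ᶠ[𝓝 s₀] fun s => ∑' q, zetaTerm f s q := by
  filter_upwards [(isOpen_convergence f.natDegree).mem_nhds hs] with s hs
  exact (hZ.hasSum s hs).tsum_eq.symm

theorem IsZetaContinuation.not_hasPoleAt (hZ : IsZetaContinuation f Z)
    (hf : ∀ x : ℝ, 0 ≤ x → 0 < f.eval x) {s₀ : ℂ}
    (hs : 2 / ((f.natDegree : ℝ) + 2) < s₀.re) : ¬ HasPoleAt Z s₀ :=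
  not_hasPoleAt_of_eventuallyEq ((hZ.eventuallyEq_tsum hs).filter_mono nhdsWithin_le_nhds)
    (hZ.meromorphic s₀) ((differentiableOn_tsum_zetaTerm hf).differentiableAt
      ((isOpen_convergence f.natDegree).mem_nhds hs)).continuousAt

theorem eventuallyEq_halfExpansion (hf : ∀ x : ℝ, 0 ≤ x → 0 < f.eval x) (hd : 1 ≤ f.natDegree)
    {K : ℕ} {s₁ : ℂ} (h1 : 2 / ((f.natDegree : ℝ) + 2) < s₁.re) (h2 : s₁.re < 1) :
    (fun s => ∑' q, zetaTerm f s q) =ᶠ[𝓝 s₁] fun s =>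
      halfExpansion f.reverse f.natDegree K s + halfExpansion f f.natDegree K s := by
  filter_upwards [(isOpen_convergence f.natDegree).mem_nhds h1,
    isOpen_setOf_re_lt_one.mem_nhds h2] with s hs1 hs2
  have hmem : s ∈ expansionDomain f.natDegree K := by
    have := two_div_lt_iff.1 (show 2 / ((f.natDegree : ℝ) + 2) < s.re from hs1)
    exact ⟨by linarith [(Nat.cast_nonneg K : (0 : ℝ) ≤ K)], hs2⟩
  rw [(hasSum_zetaTerm hf hd hs1 hs2).tsum_eq, halfZeta_eq (eval_reverse_pos hf) hmem,
    halfZeta_eq hf hmem]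

theorem IsZetaContinuation.eventuallyEq_halfExpansion (hZ : IsZetaContinuation f Z)
    (hf : ∀ x : ℝ, 0 ≤ x → 0 < f.eval x) (hd : 1 ≤ f.natDegree) {K : ℕ} {s₀ : ℂ}
    (hs : s₀ ∈ expansionDomain f.natDegree K) : Z =ᶠ[𝓝[≠] s₀] fun s =>
      halfExpansion f.reverse f.natDegree K s + halfExpansion f f.natDegree K s := by
  obtain ⟨σ, hσ1, hσ2⟩ := exists_between (two_div_lt_one hd)
  have h1 : 2 / ((f.natDegree : ℝ) + 2) < (σ : ℂ).re := by simpa using hσ1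
  have h2 : (σ : ℂ).re < 1 := by simpa using hσ2
  have hmem : (σ : ℂ) ∈ expansionDomain f.natDegree K :=
    ⟨by linarith [two_div_lt_iff.1 h1, (Nat.cast_nonneg K : (0 : ℝ) ≤ K)], h2⟩
  exact MeromorphicOn.eventuallyEq_nhdsNE_of_isPreconnected (fun s _ => hZ.meromorphic s)
    (fun s hs => (meromorphicOn_halfExpansion (eval_reverse_pos hf) _ K s hs).add
      (meromorphicOn_halfExpansion hf _ K s hs))
    (convex_expansionDomain _ K).isPreconnected hmem hs
    ((hZ.eventuallyEq_tsum h1).trans (_root_.eventuallyEq_halfExpansion hf hd h1 h2))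

open Classical in
theorem exists_isZetaContinuation (hf : ∀ x : ℝ, 0 ≤ x → 0 < f.eval x) (hd : 1 ≤ f.natDegree) :
    ∃ Z, IsZetaContinuation f Z := by
  -- The two definitions overlap in the strip `2 / (d + 2) < Re s < 1`, nonempty since `d ≥ 1`.
  refine ⟨fun s => if 2 / ((f.natDegree : ℝ) + 2) < s.re then ∑' q, zetaTerm f s q else
    halfZeta f.reverse f.natDegree s + halfZeta f f.natDegree s, fun s₀ => ?_, fun s hs => ?_⟩
  · rcases lt_or_ge (2 / ((f.natDegree : ℝ) + 2)) s₀.re with h | h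
    · have h1 := ((differentiableOn_tsum_zetaTerm hf).analyticAt
        ((isOpen_convergence f.natDegree).mem_nhds h)).meromorphicAt
      refine h1.congr (Filter.Eventually.filter_mono nhdsWithin_le_nhds ?_)
      filter_upwards [(isOpen_convergence f.natDegree).mem_nhds h] with s hs
      rw [if_pos hs]
    · obtain ⟨K, hK⟩ := exists_mem_expansionDomain f.natDegree (h.trans_lt (two_div_lt_one hd))
      have h1 := (meromorphicOn_halfExpansion (eval_reverse_pos hf) _ K s₀ hK).add
        (meromorphicOn_halfExpansion hf _ K s₀ hK)
      refine h1.congr (Filter.Eventually.filter_mono nhdsWithin_le_nhds ?_)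
      filter_upwards [(isOpen_expansionDomain f.natDegree K).mem_nhds hK] with s hs
      rw [Pi.add_apply, ← halfZeta_eq (eval_reverse_pos hf) hs, ← halfZeta_eq hf hs]
      split_ifs with h2
      · exact (hasSum_zetaTerm hf hd h2 hs.2).tsum_eq.symm
      · rfl
  · rw [if_pos hs]
    exact (summable_zetaTerm hf hs).hasSum

/-- For a constant polynomial `c` the series is `c^(-s) ζ(s)^2`. -/
theorem isZetaContinuation_of_natDegree_eq_zero (hf : ∀ x : ℝ, 0 ≤ x → 0 < f.eval x)
    (hd : f.natDegree = 0) :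
    IsZetaContinuation f fun s =>
      ((f.eval 0 : ℝ) : ℂ) ^ (-s) * (riemannZeta s * riemannZeta s) := by
  have hc := hf 0 le_rfl
  have hc' : ((f.eval 0 : ℝ) : ℂ) ≠ 0 := by exact_mod_cast hc.ne'
  refine ⟨fun s => ?_, fun s hs => ?_⟩
  · have h1 : AnalyticAt ℂ (fun s => ((f.eval 0 : ℝ) : ℂ) ^ (-s)) s :=
      Differentiable.analyticAt (differentiable_id.neg.const_cpow (Or.inl hc')) s
    exact h1.meromorphicAt.mul ((meromorphicAt_riemannZeta s).mul (meromorphicAt_riemannZeta s))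
  · have hs1 : 1 < s.re := by simpa [hd] using hs
    have hz := hasSum_pnat_cpow_neg hs1
    have hn : Summable fun n : ℕ+ => ‖(n : ℂ) ^ (-s)‖ := hz.summable.norm
    have h1 : HasSum (fun q : ℕ+ × ℕ+ => (q.1 : ℂ) ^ (-s) * (q.2 : ℂ) ^ (-s))
        (riemannZeta s * riemannZeta s) := by
      have h0 := summable_mul_of_summable_norm (f := fun n : ℕ+ => (n : ℂ) ^ (-s))
        (g := fun n : ℕ+ => (n : ℂ) ^ (-s)) hn hn
      exact HasSum.mul (f := fun n : ℕ+ => (n : ℂ) ^ (-s)) (g := fun n : ℕ+ => (n : ℂ) ^ (-s))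
        hz hz h0
    have h2 := h1.mul_left (((f.eval 0 : ℝ) : ℂ) ^ (-s))
    have h4 : zetaTerm f s = fun q : ℕ+ × ℕ+ => ((f.eval 0 : ℝ) : ℂ) ^ (-s) *
        ((q.1 : ℂ) ^ (-s) * (q.2 : ℂ) ^ (-s)) := by
      funext q
      obtain ⟨n, m⟩ := q
      have h3 : ∀ x : ℝ, f.eval x = f.eval 0 := fun x => by
        rw [Polynomial.eq_C_of_natDegree_eq_zero hd]; simp
      rw [zetaTerm, h3, hd, zero_add, pow_one, Complex.ofReal_mul, Complex.mul_cpow_ofReal_nonneg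
        (by positivity) hc.le, Complex.ofReal_mul, Complex.mul_cpow_ofReal_nonneg (by positivity)
        (by positivity)]
      push_cast
      ring
    rw [h4]
    exact h2

/-- The residue formula. The number of correction terms is taken large enough both for `s₀` to lie
in the domain of the expansion and for the `n`-th correction term to occur. -/
theorem IsZetaContinuation.tendsto_residue (hZ : IsZetaContinuation f Z)
    (hf : ∀ x : ℝ, 0 ≤ x → 0 < f.eval x) (hd : 1 ≤ f.natDegree) {s₀ : ℂ} {n : ℕ}
    (hs : s₀.re < 1) (h2 : ((f.natDegree : ℂ) + 2) * s₀ ≠ 2)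
    (hn : ((f.natDegree : ℂ) + 1) * s₀ - 1 = -(n : ℂ)) :
    Tendsto (fun s : ℂ => (s - s₀) * Z s) (𝓝[≠] s₀) (𝓝 (residueValue f s₀ n)) := by
  obtain ⟨K₀, hK₀⟩ := exists_mem_expansionDomain f.natDegree hs
  have hK : s₀ ∈ expansionDomain f.natDegree (K₀ + n) := by
    refine ⟨?_, hs⟩
    push_cast
    linarith [hK₀.1, (Nat.cast_nonneg n : (0 : ℝ) ≤ n)]
  have h3 := (tendsto_sub_mul_halfExpansion hf (Nat.le_add_left n K₀) hK h2 hn).add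
    (tendsto_sub_mul_halfExpansion (eval_reverse_pos hf) (Nat.le_add_left n K₀) hK h2 hn)
  rw [← mul_add] at h3
  refine h3.congr' ?_
  filter_upwards [hZ.eventuallyEq_halfExpansion hf hd hK] with s hs
  rw [hs]
  ring

end Continuation

theorem mainTheorem2 (f : Polynomial ℝ) (d : ℕ) (hd : f.natDegree = d)
    (hf : ∀ x : ℝ, 0 ≤ x → 0 < f.eval x) :
    (∃ Z : ℂ → ℂ, IsZetaContinuation f Z) ∧
    ∀ Z : ℂ → ℂ, IsZetaContinuation f Z →
      (∀ s₀ : ℂ, s₀ ≠ 2 / ((d : ℂ) + 2) → HasPoleAt Z s₀ →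
        meromorphicOrderAt Z s₀ = ((-1 : ℤ) : WithTop ℤ) ∧
        (∀ k : ℤ, s₀ ≠ (k : ℂ)) ∧
        ∃ n : ℕ, ((d : ℂ) + 1) * s₀ - 1 = -(n : ℂ) ∧
          Tendsto (fun s : ℂ => (s - s₀) * Z s) (𝓝[≠] s₀) (𝓝 (residueValue f s₀ n))) ∧
      (∀ (s₀ : ℂ) (n : ℕ), (∀ k : ℤ, s₀ ≠ (k : ℂ)) → ((d : ℂ) + 1) * s₀ - 1 = -(n : ℂ) →
        ((-1 : ℤ) : WithTop ℤ) ≤ meromorphicOrderAt Z s₀ ∧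
        Tendsto (fun s : ℂ => (s - s₀) * Z s) (𝓝[≠] s₀) (𝓝 (residueValue f s₀ n))) := by
  subst hd
  rcases Nat.eq_zero_or_pos f.natDegree with hd | hd
  · have hZ0 := isZetaContinuation_of_natDegree_eq_zero hf hd
    refine ⟨⟨_, hZ0⟩, fun Z hZ => ⟨fun s₀ hs₀ hpole => ?_, fun s₀ n hint hn => ?_⟩⟩
    · have hs1 : s₀ ≠ 1 := by simpa [hd] using hs₀
      refine absurd hpole (not_hasPoleAt_of_eventuallyEq (hZ.eventuallyEq hZ0 s₀)
        (hZ.meromorphic s₀) ?_)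
      have hc : ((f.eval 0 : ℝ) : ℂ) ≠ 0 := by exact_mod_cast (hf 0 le_rfl).ne'
      have hz := (differentiableAt_riemannZeta hs1).continuousAt
      exact ((differentiable_id.neg.const_cpow (Or.inl hc)) s₀).continuousAt.mul (hz.mul hz)
    -- For `d = 0` the solutions `s₀ = 1 - n` are all integers.
    · refine absurd ?_ (hint (1 - n))
      rw [hd] at hn
      push_cast at hn ⊢
      linear_combination hn
  · refine ⟨exists_isZetaContinuation hf hd, fun Z hZ => ⟨fun s₀ hs₀ hpole => ?_,
      fun s₀ n hint hn => ?_⟩⟩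
    · have hd2 : (f.natDegree : ℂ) + 2 ≠ 0 := by
        exact_mod_cast Nat.succ_ne_zero (f.natDegree + 1)
      have h2 : ((f.natDegree : ℂ) + 2) * s₀ ≠ 2 := fun h =>
        hs₀ (by field_simp; linear_combination h)
      have hre : s₀.re < 1 := by
        by_contra h
        exact hZ.not_hasPoleAt hf ((two_div_lt_one hd).trans_le (not_lt.1 h)) hpole
      obtain ⟨n, hn⟩ : ∃ n : ℕ, ((f.natDegree : ℂ) + 1) * s₀ - 1 = -(n : ℂ) := by
        by_contra! hne
        have hne' : ∀ k : ℕ, ((f.natDegree : ℂ) + 1) * s₀ + k ≠ 1 := fun k h =>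
          hne k (by linear_combination h)
        obtain ⟨K, hK⟩ := exists_mem_expansionDomain f.natDegree hre
        exact not_hasPoleAt_of_eventuallyEq (hZ.eventuallyEq_halfExpansion hf hd hK)
          (hZ.meromorphic s₀) ((continuousAt_halfExpansion (eval_reverse_pos hf) hK h2 hne').add
            (continuousAt_halfExpansion hf hK h2 hne')) hpole
      have hres := hZ.tendsto_residue hf hd hre h2 hn
      refine ⟨?_, ?_, n, hn, hres⟩
      · have h3 := neg_one_le_meromorphicOrderAt (hZ.meromorphic s₀) hres
        have h4 : meromorphicOrderAt Z s₀ < 0 := hpole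
        cases ho : meromorphicOrderAt Z s₀ with
        | top => rw [ho] at h4; exact absurd h4 (by simp)
        | coe m =>
          rw [ho] at h3 h4
          have h5 : -1 ≤ m := by exact_mod_cast h3
          have h6 : m < 0 := by exact_mod_cast h4
          exact_mod_cast (by omega : m = -1)
      · rintro k rfl
        rw [residueValue_eq_zero_of_int hd hn] at hres
        exact not_hasPoleAt_of_tendsto_zero (hZ.meromorphic _) hres hpole
    · have hd1 : (1 : ℝ) ≤ f.natDegree := by exact_mod_cast hd
      have hn0 : (0 : ℝ) ≤ n := Nat.cast_nonneg n
      have hre' : ((f.natDegree : ℝ) + 1) * s₀.re - 1 = -(n : ℝ) := by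
        simpa using congrArg Complex.re hn
      have hre : s₀.re < 1 := by nlinarith
      have h2 : ((f.natDegree : ℂ) + 2) * s₀ ≠ 2 := by
        intro h
        have h3 : ((f.natDegree : ℝ) + 2) * s₀.re = 2 := by simpa using congrArg Complex.re h
        nlinarith
      have hres := hZ.tendsto_residue hf hd hre h2 hn
      exact ⟨neg_one_le_meromorphicOrderAt (hZ.meromorphic s₀) hres, hres⟩
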